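/- Let $n,\ell,d,D\ge 1$, let $\psi:\mathbb{R}^d\to\mathbb{R}^D$ be a measurable feature map, and let $B\subset\mathbb{R}^d$. Consider a binary tree $T$ with $\ell$ leaves (every interior node has two children) and splits $(i_s,t_s)_{s\in T^\circ}\in([D]\times\mathbb{R})^{T^\circ}$ at its interior nodes. At a node $s$ a point $x$ is sent to one child if $\psi^{i_s}(x)\ge t_s$ and to the other child otherwise. Hence each $x$ reaches exactly one leaf; let $L_j$ be the set of $x$ that reach leaf $j$. Put $$\mathcal{F}_{T,(i_s,t_s)_{s\in T^\circ}}=\Big\{x\mapsto\sum_{j=1}^{\ell}\langle f_j,x\rangle\mathbf{1}(x\in L_j)\;:\;f_1,\dots,f_\ell\in B\Big\},$$ and let $\mathcal{F}$ be the union of these classes over all binary trees $T$ with $\ell$ leaves and all splits. Let $(X,Y)$ be a random element of $\mathbb{R}^d\times\mathbb{R}$ with $\|X\|_2\le K$ and $|Y|\le R$ almost surely, and suppose that $|f(x)|\le F$ for all $f\in\mathcal{F}$ and all $x$ with $\|x\|_2\le K$. Let $\mathbb{S}=(x_i,y_i)_{i=1}^n$ be an i.i.d. sample of the law of $(X,Y)$,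 and put $$L(f)=\mathbb{E}\,(f(X)-Y)^2,\qquad L_n(f)=\frac1n\sum_{i=1}^n(f(x_i)-y_i)^2,$$ $$\hat{\mathfrak{R}}_{\mathbb{S}}(\mathcal{G})=\mathbb{E}_\sigma\sup_{f\in\mathcal{G}}\frac1n\sum_{i=1}^n\sigma_i f(x_i),\qquad \mathcal{M}=\sqrt{\sup_{f\in\mathcal{F}}\frac1n\sum_{i=1}^n f(x_i)^2},$$ where $\sigma$ is uniformly distributed on $\{-1,1\}^n$. Then for every $\delta\in(0,2]$, with probability at least $1-\delta/2$ over $\mathbb{S}$, simultaneously for all $f\in\mathcal{F}$, $$L(f)-L_n(f)\le 4(R+F)\left(\max_{T,(i_s,t_s)_{s\in T^\circ}}\hat{\mathfrak{R}}_{\mathbb{S}}\big(\mathcal{F}_{T,(i_s,t_s)_{s\in T^\circ}}\big)+4\mathcal{M}\sqrt{\frac{\ell\log(enD)}{n}}+(R+2F)\sqrt{\frac{\log(2/\delta)}{2n}}\right),$$ where the maximum is over all binary trees with $\ell$ leaves and all splits. -/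

import Mathlib

open MeasureTheory

namespace RegTree

/-- The input space `ℝ^d` with the Euclidean norm. -/
abbrev Input (d : ℕ) : Type := EuclideanSpace ℝ (Fin d)

/-- A binary tree `T` together with a split `(i_s, t_s) ∈ [D] × ℝ` at each interior node `s`.
Interior nodes are the constructor `node` (two children each), leaves the constructor `nil`. -/
abbrev SplitTree (D : ℕ) : Type := BinaryTree (Fin D × ℝ)

/-- The type of leaves of a tree; it has `T.numLeaves` elements. -/
def Leaf {D : ℕ} : SplitTree D → Type
  | .nil => Unit
  | .node _ l r => Leaf l ⊕ Leaf r

/-- The leaf reached by a point `u` of the split space `ℝ^D`: at a node carrying the split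
`(i, t)` the point goes to the right child if `u i ≥ t` and to the left child otherwise. -/
noncomputable def leafAt {D : ℕ} : (T : SplitTree D) → (Fin D → ℝ) → Leaf T
  | .nil, _ => ()
  | .node s l r, u => if u s.1 ≥ s.2 then Sum.inr (leafAt r u) else Sum.inl (leafAt l u)

/-- The decision function `x ↦ ∑_j ⟪f_j, x⟫ 1(ψ(x) ∈ L_j)` of a tree with splits `T` and leaf
vectors `f_j = w j`. The leaves partition the space, so this is `⟪f_j, x⟫` for the leaf `j` that
`ψ(x)` reaches. -/
noncomputable def predict {d D : ℕ} (ψ : Input d → Fin D → ℝ) (T : SplitTree D)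
    (w : Leaf T → Input d) (x : Input d) : ℝ :=
  inner ℝ (w (leafAt T (ψ x))) x

/-- The class of decision functions with fixed tree and fixed splits, leaf vectors in `B`. -/
def fixedClass {d D : ℕ} (ψ : Input d → Fin D → ℝ) (B : Set (Input d)) (T : SplitTree D) :
    Set (Input d → ℝ) :=
  {f | ∃ w : Leaf T → Input d, (∀ j, w j ∈ B) ∧ f = predict ψ T w}

/-- The class of regression trees with `ℓ` leaves, arbitrary splits, and leaf vectors in `B`. -/
def treeClass {d D : ℕ} (ψ : Input d → Fin D → ℝ) (B : Set (Input d)) (ℓ : ℕ) :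
    Set (Input d → ℝ) :=
  {f | ∃ T : SplitTree D, T.numLeaves = ℓ ∧ f ∈ fixedClass ψ B T}

/-- The statistical risk `L(f) = E (f(X) - Y)²`. -/
noncomputable def risk {d : ℕ} (P : Measure (Input d × ℝ)) (f : Input d → ℝ) : ℝ :=
  ∫ z, (f z.1 - z.2) ^ 2 ∂P

/-- The empirical risk `L_n(f) = (1/n) ∑ (f(x_i) - y_i)²`. -/
noncomputable def empRisk {d n : ℕ} (S : Fin n → Input d × ℝ) (f : Input d → ℝ) : ℝ :=
  (1 / (n : ℝ)) * ∑ i, (f (S i).1 - (S i).2) ^ 2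

/-- The empirical Rademacher complexity `E_σ sup_{f ∈ G} (1/n) ∑ σ_i f(x_i)`, where `σ` is uniform
on `{-1, 1}^n` (here `ℤˣ = {1, -1}`). -/
noncomputable def empRademacher {d n : ℕ} (S : Fin n → Input d × ℝ) (G : Set (Input d → ℝ)) : ℝ :=
  (1 / (2 : ℝ) ^ n) * ∑ σ : Fin n → ℤˣ,
    ⨆ f : G, (1 / (n : ℝ)) * ∑ i, ((σ i : ℤ) : ℝ) * (f : Input d → ℝ) (S i).1

/-- The maximum over all trees with `ℓ` leaves and all their splits of the empirical Rademacher
complexity of the class with that tree and those splits. On a given sample only finitely many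
values occur, since the value depends only on how the tree partitions the sample. -/
noncomputable def maxEmpRademacher {d D n : ℕ} (ψ : Input d → Fin D → ℝ) (B : Set (Input d))
    (ℓ : ℕ) (S : Fin n → Input d × ℝ) : ℝ :=
  ⨆ T : {T : SplitTree D // T.numLeaves = ℓ}, empRademacher S (fixedClass ψ B T.1)

/-- `M = √(sup_{f ∈ G} (1/n) ∑ f(x_i)²)`. -/
noncomputable def supEmpNorm {d n : ℕ} (S : Fin n → Input d × ℝ) (G : Set (Input d → ℝ)) : ℝ :=
  Real.sqrt (⨆ f : G, (1 / (n : ℝ)) * ∑ i, ((f : Input d → ℝ) (S i).1) ^ 2)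

end RegTree

namespace RegTree

/-! The proof has three ingredients. The first is a uniform deviation bound for the squared loss.
Symmetrization bounds the mean deviation by twice the mean Rademacher average. McDiarmid's
inequality is applied once, to the deviation minus twice the empirical Rademacher average, so a
single event of probability `η` suffices (`measure_exists_dev_gt_le`). On the relevant range the
loss is `2(R+F)`-Lipschitz in the prediction, and contraction (`signMean_iSup_contraction`) passes
from losses to trees; this produces the factor `4(R+F)`.

The second is the passage from all trees to trees with fixed splits. On a sample a tree acts only
through its shape, the coordinate at each node and the number of sample points above each threshold.
There are at most `N = (D(n+1)+1)^(2ℓ)` such patterns, with `log N ≤ 4ℓ log(enD)`, and trees with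
one pattern induce the same functions on the sample. A union of `N` classes costs only `2√(V log N)`
(`signMean_iSup_le_of_classes`). This rests on `signMean_exp_iSup_sub_sq_le`: once the sum of
squares is subtracted inside the supremum, the exponential moment is at most the exponential of the
mean of the unpenalised supremum. It is proved by induction over the signs from a two-point
inequality, and it stands in for a concentration inequality for Rademacher suprema.

The third removes measurability problems: both bounds are proved for finite families, and the tree
class has a countable pointwise sequentially dense subclass, which is an increasing union of finite
ones. -/

/-- The mean of a function of `n` independent uniform signs. -/
noncomputable def signMean {n : ℕ} (φ : (Fin n → ℤˣ) → ℝ) : ℝ :=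
  (1 / (2 : ℝ) ^ n) * ∑ σ, φ σ

/-! ### Averages over signs and Jensen's inequality. -/

section SignMean

variable {n : ℕ}

lemma signMean_mono {φ χ : (Fin n → ℤˣ) → ℝ} (h : ∀ σ, φ σ ≤ χ σ) :
    signMean φ ≤ signMean χ := by
  unfold signMean
  gcongr
  exact h _

lemma signMean_add (φ χ : (Fin n → ℤˣ) → ℝ) :
    signMean (fun σ => φ σ + χ σ) = signMean φ + signMean χ := by
  simp [signMean, Finset.sum_add_distrib, mul_add]

lemma signMean_const_mul (c : ℝ) (φ : (Fin n → ℤˣ) → ℝ) :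
    signMean (fun σ => c * φ σ) = c * signMean φ := by
  simp only [signMean, ← Finset.mul_sum]
  ring

lemma signMean_sub (φ χ : (Fin n → ℤˣ) → ℝ) :
    signMean (fun σ => φ σ - χ σ) = signMean φ - signMean χ := by
  simp [signMean, Finset.sum_sub_distrib, mul_sub]

lemma signMean_const (c : ℝ) : signMean (fun _ : Fin n → ℤˣ => c) = c := by
  simp [signMean]

lemma signMean_neg (φ : (Fin n → ℤˣ) → ℝ) :
    signMean (fun σ => φ (-σ)) = signMean φ := by
  unfold signMean
  rw [← Equiv.sum_comp (Equiv.neg (Fin n → ℤˣ)) φ]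
  rfl

lemma signMean_sum {ι : Type*} (s : Finset ι) (φ : ι → (Fin n → ℤˣ) → ℝ) :
    signMean (fun σ => ∑ i ∈ s, φ i σ) = ∑ i ∈ s, signMean (φ i) := by
  simp only [signMean]
  rw [Finset.sum_comm, Finset.mul_sum]

lemma signMean_zero (φ : (Fin 0 → ℤˣ) → ℝ) : signMean φ = φ Fin.elim0 := by
  simp only [signMean, pow_zero, div_one, one_mul, Fintype.sum_unique]
  congr 1

lemma signMean_succ (φ : (Fin (n + 1) → ℤˣ) → ℝ) :
    signMean φ = signMean (fun σ => (φ (Fin.cons 1 σ) + φ (Fin.cons (-1) σ)) / 2) := by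
  have h : ∑ σ, φ σ = ∑ σ : Fin n → ℤˣ, (φ (Fin.cons 1 σ) + φ (Fin.cons (-1) σ)) := by
    rw [← Equiv.sum_comp (Fin.consEquiv fun _ : Fin (n + 1) => ℤˣ) φ, Fintype.sum_prod_type_right]
    refine Finset.sum_congr rfl fun σ _ => ?_
    rw [show (Finset.univ : Finset ℤˣ) = {1, -1} from rfl, Finset.sum_pair (by decide)]
    rfl
  simp only [signMean, h, ← Finset.sum_div, pow_succ]
  field_simp

/-- Jensen's inequality: the exponential lies above its tangent at the mean `m`, and the linear term
averages to zero. -/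
lemma exp_signMean_le (φ : (Fin n → ℤˣ) → ℝ) :
    Real.exp (signMean φ) ≤ signMean (fun σ => Real.exp (φ σ)) := by
  set m := signMean φ with hm
  have h : signMean (fun σ => Real.exp m * (1 + (φ σ - m))) ≤ signMean (fun σ => Real.exp (φ σ)) := by
    refine signMean_mono fun σ => ?_
    have h1 := Real.add_one_le_exp (φ σ - m)
    calc Real.exp m * (1 + (φ σ - m)) ≤ Real.exp m * Real.exp (φ σ - m) := by
          gcongr; linarith
      _ = Real.exp (φ σ) := by rw [← Real.exp_add]; ring_nf
  rw [signMean_const_mul, signMean_add, signMean_sub, signMean_const, signMean_const, ← hm] at h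
  simpa using h

/-- Convexity of `(p, q) ↦ log (exp p + exp q)`, in the form of Jensen's inequality. -/
lemma exp_signMean_add_exp_signMean_le {p q r : (Fin n → ℤˣ) → ℝ}
    (h : ∀ σ, Real.exp (p σ) + Real.exp (q σ) ≤ 2 * Real.exp (r σ)) :
    Real.exp (signMean p) + Real.exp (signMean q) ≤ 2 * Real.exp (signMean r) := by
  -- Normalising by `exp r` makes the hypothesis linear: the two exponentials of `p - r` and `q - r`
  -- sum to at most 2, and Jensen applies to each separately.
  have h1 := exp_signMean_le (fun σ => p σ - r σ)
  have h2 := exp_signMean_le (fun σ => q σ - r σ)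
  have h3 : signMean (fun σ => Real.exp (p σ - r σ) + Real.exp (q σ - r σ)) ≤
      signMean (fun _ : Fin n → ℤˣ => (2 : ℝ)) := by
    refine signMean_mono fun σ => ?_
    rw [Real.exp_sub, Real.exp_sub, ← add_div, div_le_iff₀ (Real.exp_pos _)]
    exact h σ
  rw [signMean_add, signMean_const] at h3
  rw [signMean_sub, Real.exp_sub, div_le_iff₀ (Real.exp_pos _)] at h1 h2
  nlinarith [Real.exp_pos (signMean r)]

end SignMean

/-! ### Finite suprema and the contraction principle. -/

section FiniteSup

variable {ι : Type*} [Finite ι]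

lemma le_iSup_of_finite (f : ι → ℝ) (i : ι) : f i ≤ ⨆ j, f j :=
  le_ciSup (Set.finite_range f).bddAbove i

lemma iSup_add_le_of_finite [Nonempty ι] (f g : ι → ℝ) :
    ⨆ i, (f i + g i) ≤ (⨆ i, f i) + ⨆ i, g i :=
  ciSup_le fun i => add_le_add (le_iSup_of_finite f i) (le_iSup_of_finite g i)

/-- At the maximisers `i`, `j` of the left side, `b i - b j` is at most `a i - a j` or its negative.
In the first case `i` and `j` serve as competitors on the right in the same order, in the second
they are exchanged. -/
lemma iSup_add_iSup_le_of_abs_sub_le [Nonempty ι] (h a b : ι → ℝ)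
    (hab : ∀ i j, |b i - b j| ≤ |a i - a j|) :
    (⨆ i, (h i + b i)) + ⨆ i, (h i - b i) ≤ (⨆ i, (h i + a i)) + ⨆ i, (h i - a i) := by
  obtain ⟨i, hi⟩ := exists_eq_ciSup_of_finite (f := fun i => h i + b i)
  obtain ⟨j, hj⟩ := exists_eq_ciSup_of_finite (f := fun i => h i - b i)
  rw [← hi, ← hj]
  have h1 := le_iSup_of_finite (fun i => h i + a i) i
  have h2 := le_iSup_of_finite (fun i => h i + a i) j
  have h3 := le_iSup_of_finite (fun i => h i - a i) i
  have h4 := le_iSup_of_finite (fun i => h i - a i) j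
  have h5 := (le_abs_self _).trans (hab i j)
  rcases abs_cases (a i - a j) with ⟨h6, _⟩ | ⟨h6, _⟩ <;> rw [h6] at h5 <;> linarith

/-- The contraction principle for Rademacher averages. -/
lemma signMean_iSup_contraction [Nonempty ι] {n : ℕ} (h : ι → ℝ) (a b : Fin n → ι → ℝ)
    (hab : ∀ k i j, |b k i - b k j| ≤ |a k i - a k j|) :
    signMean (fun σ => ⨆ i, (h i + ∑ k, ((σ k : ℤ) : ℝ) * b k i)) ≤
      signMean (fun σ => ⨆ i, (h i + ∑ k, ((σ k : ℤ) : ℝ) * a k i)) := by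
  induction n generalizing h with
  | zero => simp
  | succ n ih =>
    rw [signMean_succ, signMean_succ]
    simp only [Fin.sum_univ_succ, Fin.cons_zero, Fin.cons_succ, Units.val_one, Int.cast_one,
      one_mul, Units.val_neg, Int.cast_neg, neg_mul]
    -- Averaging over the first sign replaces `b 0` by `a 0`; the term `± a 0` is then absorbed into
    -- `h`, which is why the induction generalizes `h`.
    have step : ∀ σ : Fin n → ℤˣ,
        ((⨆ i, (h i + (b 0 i + ∑ k : Fin n, ((σ k : ℤ) : ℝ) * b k.succ i))) +
          ⨆ i, (h i + (-b 0 i + ∑ k : Fin n, ((σ k : ℤ) : ℝ) * b k.succ i))) / 2 ≤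
        2⁻¹ * ((⨆ i, (h i + a 0 i + ∑ k : Fin n, ((σ k : ℤ) : ℝ) * b k.succ i)) +
          ⨆ i, (h i - a 0 i + ∑ k : Fin n, ((σ k : ℤ) : ℝ) * b k.succ i)) := by
      intro σ
      have := iSup_add_iSup_le_of_abs_sub_le
        (fun i => h i + ∑ k : Fin n, ((σ k : ℤ) : ℝ) * b k.succ i) (a 0) (b 0) (hab 0)
      have e : ∀ (c : ι → ℝ) i, h i + ∑ k : Fin n, ((σ k : ℤ) : ℝ) * b k.succ i + c i =
          h i + c i + ∑ k : Fin n, ((σ k : ℤ) : ℝ) * b k.succ i := fun c i => by ring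
      have e' : ∀ (c : ι → ℝ) i, h i + ∑ k : Fin n, ((σ k : ℤ) : ℝ) * b k.succ i - c i =
          h i - c i + ∑ k : Fin n, ((σ k : ℤ) : ℝ) * b k.succ i := fun c i => by ring
      simp only [e, e'] at this
      simp only [← add_assoc, ← sub_eq_add_neg]
      linarith
    refine (signMean_mono step).trans ?_
    have ihp := ih (fun i => h i + a 0 i) (fun k => a k.succ) (fun k => b k.succ)
      fun k => hab k.succ
    have ihm := ih (fun i => h i - a 0 i) (fun k => a k.succ) (fun k => b k.succ)
      fun k => hab k.succ
    rw [signMean_const_mul, signMean_add]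
    simp only [← add_assoc, ← sub_eq_add_neg, div_eq_inv_mul]
    rw [signMean_const_mul, signMean_add]
    linarith

end FiniteSup

/-! ### Exponential moments of penalised suprema and the cost of a union of classes. -/

section Concentration

lemma cosh_le_exp_sub_quarter {x : ℝ} (hx : 1 ≤ x) : Real.cosh x ≤ Real.exp (x - 1 / 4) := by
  have h1 : Real.exp (-x) ≤ Real.exp x * (1 / 2) := by
    have h2 : 2 ≤ Real.exp (2 * x) := by linarith [Real.add_one_le_exp (2 * x)]
    have h3 : Real.exp x = Real.exp (2 * x) * Real.exp (-x) := by rw [← Real.exp_add]; ring_nf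
    rw [h3]
    nlinarith [Real.exp_pos (-x)]
  have h4 : Real.exp (x - 1 / 4) = Real.exp x * Real.exp (-(1 / 4)) := by
    rw [← Real.exp_add]; ring_nf
  have h5 : (3 / 4 : ℝ) ≤ Real.exp (-(1 / 4)) := by linarith [Real.add_one_le_exp (-(1 / 4) : ℝ)]
  rw [Real.cosh_eq, h4]
  nlinarith [Real.exp_pos x]

/-- With `x = (u - v)/2` this says `cosh x ≤ exp ((p + q - u - v)/2)`, where `p + q - u - v` is at
least both `a²` and `2x - 2a + 2a²`. For `x ≤ 1` these dominate `x²` and `cosh x ≤ exp (x²/2)`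
suffices. For `x ≥ 1` the second is at least `2x - 1/2`, because `(2a - 1)² ≥ 0`; this is the origin
of the quarter in `cosh_le_exp_sub_quarter`. -/
lemma exp_add_exp_le_of_le {u v a p q : ℝ} (huv : v ≤ u) (hp : u + a ^ 2 ≤ p)
    (hq : u - 2 * a + a ^ 2 ≤ q) (hq' : v ≤ q) :
    Real.exp u + Real.exp v ≤ 2 * Real.exp ((p + q) / 2) := by
  have key : Real.cosh ((u - v) / 2) ≤ Real.exp ((p + q - u - v) / 2) := by
    rcases le_total (u - v) 2 with h | h
    · refine (Real.cosh_le_exp_half_sq _).trans (Real.exp_le_exp.2 ?_)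
      rcases le_total ((u - v) / 2) a with h' | h'
      · nlinarith
      · nlinarith [mul_nonneg (sub_nonneg.2 h') (sub_nonneg.2 h), sq_nonneg a,
          sq_nonneg ((u - v) / 2 - a)]
    · refine (cosh_le_exp_sub_quarter (by linarith)).trans (Real.exp_le_exp.2 ?_)
      nlinarith [sq_nonneg (2 * a - 1)]
  have e1 : Real.exp u + Real.exp v =
      2 * Real.exp ((u + v) / 2) * Real.cosh ((u - v) / 2) := by
    rw [Real.cosh_eq]
    have h1 : Real.exp u = Real.exp ((u + v) / 2) * Real.exp ((u - v) / 2) := by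
      rw [← Real.exp_add]; ring_nf
    have h2 : Real.exp v = Real.exp ((u + v) / 2) * Real.exp (-((u - v) / 2)) := by
      rw [← Real.exp_add]; ring_nf
    rw [h1, h2]; ring
  have e2 : Real.exp ((p + q) / 2) =
      Real.exp ((u + v) / 2) * Real.exp ((p + q - u - v) / 2) := by
    rw [← Real.exp_add]; ring_nf
  rw [e1, e2, mul_assoc]
  gcongr

/-- The one-sign case of `signMean_exp_iSup_sub_sq_le`. The maximiser of the larger penalised
supremum is a competitor in both unpenalised suprema; the other maximiser is needed only for the
bound `v ≤ q`. The second case is the first with `a` negated. -/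
lemma exp_iSup_add_exp_iSup_le {ι : Type*} [Finite ι] [Nonempty ι] (h a : ι → ℝ) :
    Real.exp (⨆ i, (h i + (a i - a i ^ 2))) + Real.exp (⨆ i, (h i + (-a i - a i ^ 2))) ≤
      2 * Real.exp (((⨆ i, (h i + a i)) + ⨆ i, (h i + -a i)) / 2) := by
  obtain ⟨i, hi⟩ := exists_eq_ciSup_of_finite (f := fun i => h i + (a i - a i ^ 2))
  obtain ⟨j, hj⟩ := exists_eq_ciSup_of_finite (f := fun i => h i + (-a i - a i ^ 2))
  rw [← hi, ← hj]
  have h1 := le_iSup_of_finite (fun i => h i + a i) i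
  have h2 := le_iSup_of_finite (fun i => h i + a i) j
  have h3 := le_iSup_of_finite (fun i => h i + -a i) i
  have h4 := le_iSup_of_finite (fun i => h i + -a i) j
  rcases le_total (h j + (-a j - a j ^ 2)) (h i + (a i - a i ^ 2)) with h5 | h5
  · exact exp_add_exp_le_of_le (a := a i) h5 (by linarith) (by linarith)
      (by linarith [sq_nonneg (a j)])
  · rw [add_comm (Real.exp _), add_comm (⨆ i, (h i + a i))]
    exact exp_add_exp_le_of_le (a := -a j) h5 (by linarith) (by linarith)
      (by linarith [sq_nonneg (a i)])

/-- Exponential moments of a penalised Rademacher supremum are controlled by the mean of the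
unpenalised supremum. -/
lemma signMean_exp_iSup_sub_sq_le {ι : Type*} [Finite ι] [Nonempty ι] {n : ℕ} (h : ι → ℝ)
    (a : Fin n → ι → ℝ) :
    signMean (fun σ => Real.exp (⨆ i, (h i + ∑ k, (((σ k : ℤ) : ℝ) * a k i - a k i ^ 2)))) ≤
      Real.exp (signMean (fun σ => ⨆ i, (h i + ∑ k, ((σ k : ℤ) : ℝ) * a k i))) := by
  induction n generalizing h with
  | zero => simp [signMean_zero]
  | succ n ih =>
    rw [signMean_succ, signMean_succ]
    simp only [Fin.sum_univ_succ, Fin.cons_zero, Fin.cons_succ, Units.val_one, Int.cast_one,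
      one_mul, Units.val_neg, Int.cast_neg, neg_mul]
    have ihp := ih (fun i => h i + (a 0 i - a 0 i ^ 2)) (fun k => a k.succ)
    have ihm := ih (fun i => h i + (-a 0 i - a 0 i ^ 2)) (fun k => a k.succ)
    have step : ∀ σ : Fin n → ℤˣ,
        Real.exp (⨆ i, (h i + (a 0 i - a 0 i ^ 2) + ∑ k : Fin n, ((σ k : ℤ) : ℝ) * a k.succ i)) +
        Real.exp (⨆ i, (h i + (-a 0 i - a 0 i ^ 2) + ∑ k : Fin n, ((σ k : ℤ) : ℝ) * a k.succ i)) ≤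
        2 * Real.exp (((⨆ i, (h i + (a 0 i + ∑ k : Fin n, ((σ k : ℤ) : ℝ) * a k.succ i))) +
          ⨆ i, (h i + (-a 0 i + ∑ k : Fin n, ((σ k : ℤ) : ℝ) * a k.succ i))) / 2) := by
      intro σ
      have := exp_iSup_add_exp_iSup_le
        (fun i => h i + ∑ k : Fin n, ((σ k : ℤ) : ℝ) * a k.succ i) (a 0)
      simp only [add_assoc, add_comm (∑ k : Fin n, ((σ k : ℤ) : ℝ) * a k.succ _)] at this ⊢
      exact this
    -- The induction hypothesis leaves exponentials of means over the remaining signs, so the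
    -- pointwise inequality `step` must be carried through those means.
    have := exp_signMean_add_exp_signMean_le step
    simp only [div_eq_inv_mul, ← add_assoc] at this ⊢
    rw [signMean_const_mul, signMean_add]
    linarith

/-- The Rademacher average of a union of `N` classes exceeds the largest Rademacher average by at
most `2 √(V log N)`, where `V` bounds the squared Euclidean norms. -/
lemma signMean_iSup_le_of_classes {ι κ : Type*} [Fintype ι] [Nonempty ι] [DecidableEq κ] {n : ℕ}
    (q : ι → κ) (N : ℕ) (hN : (Finset.univ.image q).card ≤ N) (a : Fin n → ι → ℝ) (V μ : ℝ)
    (hV : ∀ i, ∑ k, a k i ^ 2 ≤ V)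
    (hμ : ∀ c ∈ Finset.univ.image q,
      signMean (fun σ => ⨆ i : {i // q i = c}, ∑ k, ((σ k : ℤ) : ℝ) * a k i) ≤ μ) :
    signMean (fun σ => ⨆ i, ∑ k, ((σ k : ℤ) : ℝ) * a k i) ≤ μ + 2 * Real.sqrt (V * Real.log N) := by
  set E := signMean (fun σ => ⨆ i, ∑ k, ((σ k : ℤ) : ℝ) * a k i) with hE
  have hV0 : 0 ≤ V := (Finset.sum_nonneg fun k _ => sq_nonneg _).trans (hV (Classical.arbitrary ι))
  have hpos : 0 < (Finset.univ.image q).card :=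
    Finset.card_pos.2 (Finset.univ_nonempty.image q)
  have hN1 : (1 : ℝ) ≤ N := by exact_mod_cast hpos.trans_le hN
  have hL : 0 ≤ Real.log N := Real.log_nonneg hN1
  have key : ∀ t : ℝ, 0 ≤ t → t * E ≤ Real.log N + t ^ 2 * V + t * μ := by
    intro t ht
    have h1 : Real.exp (t * E) ≤
        signMean (fun σ => Real.exp (t * ⨆ i, ∑ k, ((σ k : ℤ) : ℝ) * a k i)) := by
      rw [hE, ← signMean_const_mul]
      exact exp_signMean_le _
    -- The maximiser lies in one of the classes; the factor `exp (t² V)` pays for the penalty `∑ (t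
    -- a)²` inserted there.
    have h2 : ∀ σ : Fin n → ℤˣ, Real.exp (t * ⨆ i, ∑ k, ((σ k : ℤ) : ℝ) * a k i) ≤
        ∑ c ∈ Finset.univ.image q, Real.exp (t ^ 2 * V) * Real.exp (⨆ i : {i // q i = c},
          (0 + ∑ k, (((σ k : ℤ) : ℝ) * (t * a k i) - (t * a k i) ^ 2))) := by
      intro σ
      obtain ⟨i, hi⟩ := exists_eq_ciSup_of_finite
        (f := fun i => ∑ k, ((σ k : ℤ) : ℝ) * a k i)
      rw [← hi]
      have h3 := le_iSup_of_finite (fun i' : {i' // q i' = q i} =>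
        (0 + ∑ k, (((σ k : ℤ) : ℝ) * (t * a k i') - (t * a k i') ^ 2))) ⟨i, rfl⟩
      refine le_trans ?_ (Finset.single_le_sum (f := fun c => Real.exp (t ^ 2 * V) *
        Real.exp (⨆ i : {i // q i = c},
          (0 + ∑ k, (((σ k : ℤ) : ℝ) * (t * a k i) - (t * a k i) ^ 2))))
        (fun _ _ => by positivity) (Finset.mem_image_of_mem q (Finset.mem_univ i)))
      rw [← Real.exp_add, Real.exp_le_exp]
      refine le_trans ?_ (add_le_add_right h3 _)
      simp only [Finset.sum_sub_distrib, mul_pow, ← Finset.mul_sum, mul_left_comm _ t, zero_add]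
      nlinarith [hV i, sq_nonneg t]
    have h4 : ∀ c ∈ Finset.univ.image q, signMean (fun σ : Fin n → ℤˣ => Real.exp (t ^ 2 * V) *
        Real.exp (⨆ i : {i // q i = c},
          (0 + ∑ k, (((σ k : ℤ) : ℝ) * (t * a k i) - (t * a k i) ^ 2)))) ≤
        Real.exp (t ^ 2 * V) * Real.exp (t * μ) := by
      intro c hc
      obtain ⟨i, -, hi⟩ := Finset.mem_image.1 hc
      have : Nonempty {i // q i = c} := ⟨⟨i, hi⟩⟩
      rw [signMean_const_mul]
      gcongr
      refine (signMean_exp_iSup_sub_sq_le (fun _ : {i // q i = c} => 0)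
        (fun k i => t * a k i)).trans (Real.exp_le_exp.2 ?_)
      simp only [zero_add, mul_left_comm _ t, ← Finset.mul_sum, ← Real.mul_iSup_of_nonneg ht]
      rw [signMean_const_mul]
      exact mul_le_mul_of_nonneg_left (hμ c hc) ht
    have h5 := h1.trans (signMean_mono h2)
    rw [signMean_sum] at h5
    have h6 := h5.trans (Finset.sum_le_sum h4)
    rw [Finset.sum_const, nsmul_eq_mul, ← Real.exp_add] at h6
    have h7 : Real.exp (t * E) ≤ Real.exp (Real.log N + (t ^ 2 * V + t * μ)) := by
      rw [Real.exp_add (Real.log N), Real.exp_log (by linarith)]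
      refine h6.trans ?_
      gcongr
    linarith [Real.exp_le_exp.1 h7]
  rcases le_total E μ with h | h
  · linarith [Real.sqrt_nonneg (V * Real.log N)]
  -- For negative `t` this is trivial since `E ≥ μ`. Reading off the discriminant replaces
  -- optimising over `t` and includes the case `V = 0`.
  have h8 : ∀ t : ℝ, 0 ≤ V * (t * t) + (-(E - μ)) * t + Real.log N := by
    intro t
    rcases le_total 0 t with ht | ht
    · linarith [key t ht]
    · nlinarith [mul_nonneg hV0 (mul_self_nonneg t), mul_nonneg (sub_nonneg.2 h) (neg_nonneg.2 ht)]
  have h9 := discrim_le_zero h8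
  rw [discrim] at h9
  have h10 : E - μ ≤ 2 * Real.sqrt (V * Real.log N) := by
    refine abs_le_of_sq_le_sq' ?_ (by positivity) |>.2
    rw [mul_pow, Real.sq_sqrt (by positivity)]
    linarith
  linarith

end Concentration

/-! ### Size and stability of finite suprema. -/

section FiniteSupBounds

variable {ι : Type*} [Finite ι] [Nonempty ι]

lemma abs_iSup_le_of_finite {f : ι → ℝ} {C : ℝ} (h : ∀ i, |f i| ≤ C) : |⨆ i, f i| ≤ C := by
  obtain ⟨i, hi⟩ := exists_eq_ciSup_of_finite (f := f)
  exact hi ▸ h i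

lemma abs_iSup_sub_iSup_le {f g : ι → ℝ} {c : ℝ} (h : ∀ i, |f i - g i| ≤ c) :
    |(⨆ i, f i) - ⨆ i, g i| ≤ c := by
  rw [abs_sub_le_iff]
  constructor
  · rw [sub_le_iff_le_add]
    exact ciSup_le fun i => by
      linarith [le_iSup_of_finite g i, (abs_sub_le_iff.1 (h i)).1]
  · rw [sub_le_iff_le_add]
    exact ciSup_le fun i => by
      linarith [le_iSup_of_finite f i, (abs_sub_le_iff.1 (h i)).2]

end FiniteSupBounds

/-! ### Hoeffding's lemma and McDiarmid's inequality. -/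

section BoundedDifferences

lemma integrable_of_abs_le {Ω : Type*} [MeasurableSpace Ω] {μ : Measure Ω} [IsFiniteMeasure μ]
    {f : Ω → ℝ} (hf : Measurable f) {C : ℝ} (hC : ∀ ω, |f ω| ≤ C) : Integrable f μ :=
  Integrable.of_bound hf.aestronglyMeasurable C (ae_of_all _ hC)

lemma abs_integral_le_of_abs_le {Ω : Type*} [MeasurableSpace Ω] {μ : Measure Ω}
    [IsProbabilityMeasure μ] {f : Ω → ℝ} {C : ℝ} (hC : ∀ ω, |f ω| ≤ C) : |∫ ω, f ω ∂μ| ≤ C := by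
  simpa using norm_integral_le_of_norm_le_const (μ := μ) (f := f) (C := C) (ae_of_all _ hC)

variable {Z : Type*} [MeasurableSpace Z]

lemma measurable_finCons {n : ℕ} :
    Measurable fun p : Z × (Fin n → Z) => (Fin.cons p.1 p.2 : Fin (n + 1) → Z) := by
  refine measurable_pi_iff.2 fun k => ?_
  refine Fin.cases ?_ (fun j => ?_) k
  · simpa using measurable_fst
  · simpa [Function.comp_def] using (measurable_pi_apply j).comp measurable_snd

lemma integral_pi_succ (P : Measure Z) [IsProbabilityMeasure P] {n : ℕ}
    {f : (Fin (n + 1) → Z) → ℝ} (hf : Measurable f) {C : ℝ} (hC : ∀ S, |f S| ≤ C) :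
    ∫ S, f S ∂(Measure.pi fun _ => P) =
      ∫ S, ∫ z, f (Fin.cons z S) ∂P ∂(Measure.pi fun _ : Fin n => P) := by
  have h := (measurePreserving_piFinSuccAbove (fun _ : Fin (n + 1) => P) 0).symm
  rw [← h.integral_comp' f]
  have hint : Integrable (fun p : Z × (Fin n → Z) => f (Fin.cons p.1 p.2))
      (P.prod (Measure.pi fun _ : Fin n => P)) :=
    integrable_of_abs_le (hf.comp measurable_finCons) fun _ => hC _
  rw [← integral_prod_symm _ hint]
  refine integral_congr_ae (ae_of_all _ fun p => ?_)
  exact congrArg f (Fin.insertNth_zero' p.1 p.2)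

/-- Hoeffding's lemma for a function whose oscillation is at most `c`. -/
lemma integral_exp_le_of_oscillation (P : Measure Z) [IsProbabilityMeasure P] {X : Z → ℝ}
    (hX : Measurable X) {C : ℝ} (hC : ∀ z, |X z| ≤ C) {c : ℝ} (hc : ∀ z z', |X z - X z'| ≤ c)
    (t : ℝ) : ∫ z, Real.exp (t * (X z - ∫ z', X z' ∂P)) ∂P ≤ Real.exp (c ^ 2 * t ^ 2 / 8) := by
  have hne : Nonempty Z := nonempty_of_isProbabilityMeasure P
  have hbdd : BddBelow (Set.range X) := ⟨-C, by
    rintro _ ⟨z, rfl⟩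
    exact (abs_le.1 (hC z)).1⟩
  have hmem : ∀ᵐ z ∂P, X z ∈ Set.Icc (⨅ z, X z) ((⨅ z, X z) + c) := by
    refine ae_of_all _ fun z => ⟨ciInf_le hbdd z, ?_⟩
    rw [← sub_le_iff_le_add]
    exact le_ciInf fun z' => by linarith [(abs_sub_le_iff.1 (hc z z')).1]
  have h := (ProbabilityTheory.hasSubgaussianMGF_of_mem_Icc hX.aemeasurable hmem).mgf_le t
  rw [ProbabilityTheory.mgf] at h
  refine h.trans (Real.exp_le_exp.2 (le_of_eq ?_))
  simp only [add_sub_cancel_left, NNReal.coe_pow, NNReal.coe_div, coe_nnnorm, Real.norm_eq_abs,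
    NNReal.coe_ofNat, div_pow, sq_abs]
  ring

/-- **McDiarmid's inequality**, bound on the exponential moments. -/
lemma integral_exp_le_of_bounded_differences (P : Measure Z) [IsProbabilityMeasure P] {n : ℕ}
    {Φ : (Fin n → Z) → ℝ} (hΦ : Measurable Φ) {C : ℝ} (hC : ∀ S, |Φ S| ≤ C) {c : ℝ}
    (hc : ∀ S k z, |Φ (Function.update S k z) - Φ S| ≤ c) (t : ℝ) :
    ∫ S, Real.exp (t * (Φ S - ∫ S', Φ S' ∂(Measure.pi fun _ => P))) ∂(Measure.pi fun _ => P) ≤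
      Real.exp (n * (c ^ 2 * t ^ 2 / 8)) := by
  induction n with
  | zero =>
    rw [Measure.pi_of_empty]
    simp
  | succ n ih =>
    -- Integrating out the first coordinate preserves the bound and the bounded differences. Given
    -- the other coordinates, Hoeffding's lemma controls the fluctuation of `Φ` around `φ`, and the
    -- induction hypothesis controls that of `φ`.
    set φ : (Fin n → Z) → ℝ := fun S => ∫ z, Φ (Fin.cons z S) ∂P with hφ
    have hm2 : Measurable fun p : Z × (Fin n → Z) => Φ (Fin.cons p.1 p.2) :=
      hΦ.comp measurable_finCons
    have hφm : Measurable φ :=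
      (hm2.stronglyMeasurable.integral_prod_left' (μ := P)).measurable
    have hφC : ∀ S, |φ S| ≤ C := fun S => abs_integral_le_of_abs_le fun _ => hC _
    have hsec : ∀ S : Fin n → Z, Measurable fun z => Φ (Fin.cons z S) := fun S =>
      hm2.comp (measurable_id.prodMk measurable_const)
    have hφc : ∀ S k z, |φ (Function.update S k z) - φ S| ≤ c := by
      intro S k z
      simp only [hφ]
      rw [← integral_sub (integrable_of_abs_le (hsec _) fun _ => hC _)
        (integrable_of_abs_le (hsec _) fun _ => hC _)]
      refine abs_integral_le_of_abs_le fun z' => ?_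
      rw [Fin.cons_update]
      exact hc _ _ _
    have ih' := ih hφm hφC hφc
    set m := ∫ S', Φ S' ∂(Measure.pi fun _ : Fin (n + 1) => P) with hmdef
    have hmφ : m = ∫ S', φ S' ∂(Measure.pi fun _ : Fin n => P) := integral_pi_succ P hΦ hC
    rw [← hmφ] at ih'
    have hmC : |m| ≤ C := abs_integral_le_of_abs_le hC
    have hbound : ∀ x : ℝ, |x| ≤ C → |Real.exp (t * (x - m))| ≤ Real.exp (|t| * (2 * C)) := by
      intro x hx
      rw [Real.abs_exp, Real.exp_le_exp]
      refine (le_abs_self _).trans ?_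
      rw [abs_mul]
      gcongr
      exact (abs_sub _ _).trans (by linarith)
    rw [integral_pi_succ P (f := fun S => Real.exp (t * (Φ S - m)))
      ((hΦ.sub_const m).const_mul t).exp (fun S => hbound _ (hC S))]
    have hinner : ∀ S : Fin n → Z, ∫ z, Real.exp (t * (Φ (Fin.cons z S) - m)) ∂P ≤
        Real.exp (c ^ 2 * t ^ 2 / 8) * Real.exp (t * (φ S - m)) := by
      intro S
      have h1 := integral_exp_le_of_oscillation P (hsec S) (fun z => hC _) (c := c)
        (fun z z' => by
          have := hc (Fin.cons z' S) 0 z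
          rwa [Fin.update_cons_zero] at this) t
      calc ∫ z, Real.exp (t * (Φ (Fin.cons z S) - m)) ∂P
          = ∫ z, Real.exp (t * (Φ (Fin.cons z S) - φ S)) * Real.exp (t * (φ S - m)) ∂P := by
            congr 1 with z
            rw [← Real.exp_add]; ring_nf
        _ ≤ _ := by
            rw [integral_mul_const]
            gcongr
    have hm3 : Measurable fun S : Fin n → Z => ∫ z, Real.exp (t * (Φ (Fin.cons z S) - m)) ∂P :=
      (((hm2.sub_const m).const_mul t).exp.stronglyMeasurable.integral_prod_left'
        (μ := P)).measurable
    calc _ ≤ ∫ S, Real.exp (c ^ 2 * t ^ 2 / 8) * Real.exp (t * (φ S - m))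
          ∂(Measure.pi fun _ : Fin n => P) := by
          refine integral_mono (integrable_of_abs_le hm3 fun S =>
            abs_integral_le_of_abs_le fun z => hbound _ (hC _)) ?_ hinner
          exact (integrable_of_abs_le ((hφm.sub_const m).const_mul t).exp
            fun S => hbound _ (hφC S)).const_mul _
      _ ≤ Real.exp (c ^ 2 * t ^ 2 / 8) * Real.exp (n * (c ^ 2 * t ^ 2 / 8)) := by
          rw [integral_const_mul]
          gcongr
      _ = _ := by
          rw [← Real.exp_add]; push_cast; ring_nf

/-- **McDiarmid's inequality**, upper tail. -/
lemma measure_gt_le_of_bounded_differences (P : Measure Z) [IsProbabilityMeasure P] {n : ℕ}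
    (hn : 0 < n) {Φ : (Fin n → Z) → ℝ} (hΦ : Measurable Φ) {C : ℝ} (hC : ∀ S, |Φ S| ≤ C) {c : ℝ}
    (hc0 : 0 < c) (hc : ∀ S k z, |Φ (Function.update S k z) - Φ S| ≤ c) {η : ℝ} (hη : 0 < η)
    (hη1 : η ≤ 1) :
    (Measure.pi fun _ : Fin n => P) {S | (∫ S', Φ S' ∂(Measure.pi fun _ => P)) +
      c * Real.sqrt (n * Real.log (1 / η) / 2) ≤ Φ S} ≤ ENNReal.ofReal η := by
  set Q := Measure.pi fun _ : Fin n => P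
  set m := ∫ S', Φ S' ∂Q
  set L := Real.log (1 / η) with hL
  have hL0 : 0 ≤ L := Real.log_nonneg (by rw [le_div_iff₀ hη]; linarith)
  have hn' : (0 : ℝ) < n := by exact_mod_cast hn
  set s := Real.sqrt (n * L / 2) with hs
  have hs2 : s ^ 2 = n * L / 2 := Real.sq_sqrt (by positivity)
  -- This `t` minimises the Chernoff exponent `-t c s + n c² t² / 8`, with minimum `-2 s² / n = -L`.
  set t := 4 * s / (n * c) with ht
  have ht0 : 0 ≤ t := by positivity
  have hint : Integrable (fun S => Real.exp (t * (Φ S - m))) Q := by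
    refine integrable_of_abs_le (C := Real.exp (t * (C - m))) ((hΦ.sub_const m).const_mul t).exp
      fun S => ?_
    rw [Real.abs_exp]
    gcongr
    exact (abs_le.1 (hC S)).2
  have h1 := ProbabilityTheory.measure_ge_le_exp_mul_mgf (X := fun S => Φ S - m) (μ := Q)
    (c * s) ht0 hint
  rw [ProbabilityTheory.mgf] at h1
  have h2 := h1.trans (mul_le_mul_of_nonneg_left
    (integral_exp_le_of_bounded_differences P hΦ hC hc t) (Real.exp_pos _).le)
  have h3 : Real.exp (-t * (c * s)) * Real.exp (n * (c ^ 2 * t ^ 2 / 8)) = η := by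
    rw [← Real.exp_add]
    have : -t * (c * s) + n * (c ^ 2 * t ^ 2 / 8) = -L := by
      rw [ht]
      field_simp
      linear_combination (-16 : ℝ) * hs2
    rw [this, hL, one_div, Real.log_inv, neg_neg, Real.exp_log hη]
  rw [h3] at h2
  have h4 : {S | m + c * s ≤ Φ S} = {S | c * s ≤ Φ S - m} := by
    ext S
    simp [le_sub_iff_add_le, add_comm]
  rw [h4, ← ofReal_measureReal]
  exact ENNReal.ofReal_le_ofReal h2

end BoundedDifferences

/-! ### Symmetrization and the uniform deviation inequality. -/

section Symmetrization

lemma abs_signMean_le {n : ℕ} {φ : (Fin n → ℤˣ) → ℝ} {C : ℝ} (h : ∀ σ, |φ σ| ≤ C) :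
    |signMean φ| ≤ C := by
  rw [abs_le]
  constructor
  · rw [← signMean_const (n := n) (-C)]
    exact signMean_mono fun σ => (abs_le.1 (h σ)).1
  · rw [← signMean_const (n := n) C]
    exact signMean_mono fun σ => (abs_le.1 (h σ)).2

lemma abs_units_cast (s : ℤˣ) : |((s : ℤ) : ℝ)| = 1 := by
  rcases Int.units_eq_one_or s with h | h <;> simp [h]

lemma abs_sum_le_of_abs_le {n : ℕ} {f : Fin n → ℝ} {C : ℝ} (h : ∀ k, |f k| ≤ C) :
    |∑ k, f k| ≤ n * C :=
  (Finset.abs_sum_le_sum_abs _ _).trans <| (Finset.sum_le_sum fun k _ => h k).trans <| by simp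

/-- The supremum of a Rademacher process along a sample. -/
noncomputable def radSup {Z ι : Type*} {n : ℕ} (g : ι → Z → ℝ) (σ : Fin n → ℤˣ) (S : Fin n → Z) : ℝ :=
  ⨆ i, ∑ k, ((σ k : ℤ) : ℝ) * g i (S k)

lemma measurable_radSup {Z ι : Type*} [MeasurableSpace Z] [Finite ι] {n : ℕ} {g : ι → Z → ℝ} (hg : ∀ i, Measurable (g i)) (σ : Fin n → ℤˣ) :
    Measurable (radSup g σ) :=
  Measurable.iSup fun i => Finset.measurable_sum _ fun k _ =>
    ((hg i).comp (measurable_pi_apply k)).const_mul _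

lemma abs_radSup_le {Z ι : Type*} [Finite ι] [Nonempty ι] {n : ℕ} {g : ι → Z → ℝ} {C : ℝ} (hC : ∀ i z, |g i z| ≤ C) (σ : Fin n → ℤˣ)
    (S : Fin n → Z) : |radSup g σ S| ≤ n * C :=
  abs_iSup_le_of_finite fun i => abs_sum_le_of_abs_le fun k => by
    rw [abs_mul, abs_units_cast, one_mul]
    exact hC i _

lemma integral_signMean {Ω : Type*} [MeasurableSpace Ω] {μ : Measure Ω} {n : ℕ}
    {φ : (Fin n → ℤˣ) → Ω → ℝ} (h : ∀ σ, Integrable (φ σ) μ) :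
    ∫ ω, signMean (fun σ => φ σ ω) ∂μ = signMean fun σ => ∫ ω, φ σ ω ∂μ := by
  simp only [signMean]
  rw [integral_const_mul, integral_finsetSum _ fun σ _ => h σ]

lemma integral_comp_of_measurePreserving {α β : Type*} [MeasurableSpace α] [MeasurableSpace β]
    {μ : Measure α} {ν : Measure β} {f : α → β} (hf : MeasurePreserving f μ ν) {φ : β → ℝ}
    (hφ : Measurable φ) : ∫ x, φ (f x) ∂μ = ∫ y, φ y ∂ν := by
  rw [← hf.map_eq, integral_map hf.measurable.aemeasurable hφ.aestronglyMeasurable]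

variable {Z : Type*} [MeasurableSpace Z] {ι : Type*} [Finite ι] [Nonempty ι]

/-- Exchanging a sample with an independent copy at the coordinates where `σ` is `-1` does not
change the law of the pair. -/
lemma integral_iSup_diff_le (P : Measure Z) [IsProbabilityMeasure P] {n : ℕ} {g : ι → Z → ℝ}
    (hg : ∀ i, Measurable (g i)) {C : ℝ} (hC : ∀ i z, |g i z| ≤ C) (σ : Fin n → ℤˣ) :
    ∫ p : (Fin n → Z) × (Fin n → Z), ⨆ i, ∑ k, (g i (p.2 k) - g i (p.1 k))
        ∂((Measure.pi fun _ => P).prod (Measure.pi fun _ => P)) ≤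
      (∫ S, radSup g σ S ∂(Measure.pi fun _ => P)) +
        ∫ S, radSup g (-σ) S ∂(Measure.pi fun _ => P) := by
  set W := Measure.pi fun _ : Fin n => P.prod P
  have h1 := measurePreserving_arrowProdEquivProdArrow Z Z (Fin n) (fun _ => P) (fun _ => P)
  rw [← h1.integral_comp']
  have hτ : ∀ k, MeasurePreserving (if σ k = 1 then id else Prod.swap : Z × Z → Z × Z)
      (P.prod P) (P.prod P) := by
    intro k
    split_ifs
    · exact MeasurePreserving.id _
    · exact Measure.measurePreserving_swap
  have h2 := measurePreserving_pi (fun _ : Fin n => P.prod P) (fun _ => P.prod P) hτ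
  have hHm : Measurable fun w : Fin n → Z × Z => ⨆ i, ∑ k, (g i (w k).2 - g i (w k).1) :=
    Measurable.iSup fun i => Finset.measurable_sum _ fun k _ =>
      ((hg i).comp (measurable_snd.comp (measurable_pi_apply k))).sub
        ((hg i).comp (measurable_fst.comp (measurable_pi_apply k)))
  have h3 : ∫ w, (⨆ i, ∑ k, (g i (w k).2 - g i (w k).1)) ∂W =
      ∫ w, (⨆ i, ∑ k, ((σ k : ℤ) : ℝ) * (g i (w k).2 - g i (w k).1)) ∂W := by
    rw [← integral_comp_of_measurePreserving h2 hHm]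
    refine integral_congr_ae (ae_of_all _ fun w => ?_)
    refine iSup_congr fun i => Finset.sum_congr rfl fun k _ => ?_
    rcases Int.units_eq_one_or (σ k) with h | h
    · simp [h]
    · simp [h]
  have hfst : MeasurePreserving (fun (w : Fin n → Z × Z) k => (w k).1) W
      (Measure.pi fun _ => P) :=
    measurePreserving_pi (fun _ : Fin n => P.prod P) (fun _ => P) fun _ => measurePreserving_fst
  have hsnd : MeasurePreserving (fun (w : Fin n → Z × Z) k => (w k).2) W
      (Measure.pi fun _ => P) :=
    measurePreserving_pi (fun _ : Fin n => P.prod P) (fun _ => P) fun _ => measurePreserving_snd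
  have h4 : ∫ w, radSup g σ (fun k => (w k).2) ∂W =
      ∫ S, radSup g σ S ∂(Measure.pi fun _ => P) :=
    integral_comp_of_measurePreserving hsnd (measurable_radSup hg σ)
  have h5 : ∫ w, radSup g (-σ) (fun k => (w k).1) ∂W =
      ∫ S, radSup g (-σ) S ∂(Measure.pi fun _ => P) :=
    integral_comp_of_measurePreserving hfst (measurable_radSup hg (-σ))
  have i4 : Integrable (fun w : Fin n → Z × Z => radSup g σ (fun k => (w k).2)) W :=
    integrable_of_abs_le ((measurable_radSup hg σ).comp hsnd.measurable)
      fun _ => abs_radSup_le hC _ _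
  have i5 : Integrable (fun w : Fin n → Z × Z => radSup g (-σ) (fun k => (w k).1)) W :=
    integrable_of_abs_le ((measurable_radSup hg (-σ)).comp hfst.measurable)
      fun _ => abs_radSup_le hC _ _
  rw [← h4, ← h5, ← integral_add i4 i5]
  refine (show _ = _ from h3).trans_le ?_
  have i3 : Integrable
      (fun w => ⨆ i, ∑ k, ((σ k : ℤ) : ℝ) * (g i (w k).2 - g i (w k).1)) W := by
    refine integrable_of_abs_le (C := n * (2 * C)) (Measurable.iSup fun i =>
      Finset.measurable_sum _ fun k _ =>
      (((hg i).comp (measurable_snd.comp (measurable_pi_apply k))).sub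
        ((hg i).comp (measurable_fst.comp (measurable_pi_apply k)))).const_mul _) fun w =>
      abs_iSup_le_of_finite fun i => abs_sum_le_of_abs_le fun k => ?_
    rw [abs_mul, abs_units_cast, one_mul]
    exact (abs_sub _ _).trans (by linarith [hC i (w k).1, hC i (w k).2])
  refine integral_mono i3 (i4.add i5) fun w => ?_
  refine le_trans (le_of_eq ?_) (iSup_add_le_of_finite _ _)
  refine iSup_congr fun i => ?_
  rw [← Finset.sum_add_distrib]
  refine Finset.sum_congr rfl fun k _ => ?_
  simp only [Pi.neg_apply, Units.val_neg, Int.cast_neg]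
  ring

/-- **Symmetrization** for a finite class of bounded functions. -/
lemma integral_iSup_dev_le (P : Measure Z) [IsProbabilityMeasure P] {n : ℕ} {g : ι → Z → ℝ}
    (hg : ∀ i, Measurable (g i)) {C : ℝ} (hC : ∀ i z, |g i z| ≤ C) :
    ∫ S : Fin n → Z, ⨆ i, ∑ k, ((∫ z, g i z ∂P) - g i (S k)) ∂(Measure.pi fun _ => P) ≤
      2 * ∫ S : Fin n → Z, signMean (fun σ => radSup g σ S) ∂(Measure.pi fun _ => P) := by
  set Q := Measure.pi fun _ : Fin n => P
  have hgk : ∀ i (k : Fin n), Measurable fun S : Fin n → Z => g i (S k) := fun i k =>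
    (hg i).comp (measurable_pi_apply k)
  have hbd : ∀ (i : ι) (x y : ℝ) (z : Z), |x| ≤ C → |y| ≤ C → |x - y| ≤ 2 * C :=
    fun i x y z hx hy => (abs_sub _ _).trans (by linarith)
  have hmeasH : Measurable fun p : (Fin n → Z) × (Fin n → Z) =>
      ⨆ i, ∑ k, (g i (p.2 k) - g i (p.1 k)) :=
    Measurable.iSup fun i => Finset.measurable_sum _ fun k _ =>
      ((hgk i k).comp measurable_snd).sub ((hgk i k).comp measurable_fst)
  have hHC : ∀ p : (Fin n → Z) × (Fin n → Z),
      |⨆ i, ∑ k, (g i (p.2 k) - g i (p.1 k))| ≤ n * (2 * C) := fun p =>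
    abs_iSup_le_of_finite fun i => abs_sum_le_of_abs_le fun k => hbd i _ _ (p.1 k) (hC _ _) (hC _ _)
  have hHint := integrable_of_abs_le (μ := Q.prod Q) hmeasH hHC
  have hsec : ∀ S : Fin n → Z,
      Integrable (fun S' : Fin n → Z => ⨆ i, ∑ k, (g i (S' k) - g i (S k))) Q := fun S =>
    integrable_of_abs_le (hmeasH.comp (measurable_const.prodMk measurable_id)) fun S' => hHC (S, S')
  -- The expectation is the mean over a ghost sample `S'`; the supremum of these integrals is at
  -- most the integral of the supremum.
  have hA : ∀ S : Fin n → Z, ⨆ i, ∑ k, ((∫ z, g i z ∂P) - g i (S k)) ≤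
      ∫ S', ⨆ i, ∑ k, (g i (S' k) - g i (S k)) ∂Q := by
    intro S
    refine ciSup_le fun i => ?_
    have hi : ∀ k, Integrable (fun S' : Fin n → Z => g i (S' k)) Q := fun k =>
      integrable_of_abs_le (hgk i k) fun _ => hC _ _
    have e : ∑ k, ((∫ z, g i z ∂P) - g i (S k)) = ∫ S', ∑ k, (g i (S' k) - g i (S k)) ∂Q := by
      rw [integral_finsetSum Finset.univ (f := fun k (S' : Fin n → Z) => g i (S' k) - g i (S k))
        fun k _ => (hi k).sub (integrable_const _)]
      refine Finset.sum_congr rfl fun k _ => ?_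
      rw [integral_sub (hi k) (integrable_const _), integral_const]
      have := integral_comp_eval (μ := fun _ : Fin n => P) (i := k) (f := g i)
        (hg i).aestronglyMeasurable
      rw [← this]
      simp [Q]
    rw [e]
    exact integral_mono (integrable_finsetSum _ fun k _ => (hi k).sub (integrable_const _))
      (hsec S) fun S' => le_iSup_of_finite (fun i => ∑ k, (g i (S' k) - g i (S k))) i
  have hAint : Integrable (fun S : Fin n → Z => ⨆ i, ∑ k, ((∫ z, g i z ∂P) - g i (S k))) Q :=
    integrable_of_abs_le (C := n * (2 * C)) (Measurable.iSup fun i =>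
      Finset.measurable_sum _ fun k _ => (hgk i k).const_sub _) fun S =>
      abs_iSup_le_of_finite fun i => abs_sum_le_of_abs_le fun k =>
        hbd i _ _ (S k) (abs_integral_le_of_abs_le (hC i)) (hC _ _)
  have h1 := (integral_mono hAint hHint.integral_prod_left hA).trans_eq
    (integral_prod _ hHint).symm
  have h2 : ∫ p, (⨆ i, ∑ k, (g i (p.2 k) - g i (p.1 k))) ∂(Q.prod Q) ≤
      signMean fun σ : Fin n → ℤˣ => (∫ S, radSup g σ S ∂Q) + ∫ S, radSup g (-σ) S ∂Q := by
    -- The left side does not depend on `σ`, so the bound may be averaged over `σ`; since `-σ` has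
    -- the law of `σ`, the two terms coincide on average, giving the factor 2.
    rw [← signMean_const (n := n) (∫ p, _ ∂(Q.prod Q))]
    exact signMean_mono fun σ => integral_iSup_diff_le P hg hC σ
  rw [signMean_add, signMean_neg (fun σ : Fin n → ℤˣ => ∫ S, radSup g σ S ∂Q)] at h2
  rw [integral_signMean fun σ => integrable_of_abs_le (measurable_radSup hg σ)
    fun _ => abs_radSup_le hC _ _]
  linarith

/-- A one-sided uniform deviation inequality with an empirical Rademacher complexity, for a finite
class of functions with values in `[0, b]`. -/
lemma measure_exists_dev_gt_le (P : Measure Z) [IsProbabilityMeasure P] {n : ℕ} (hn : 0 < n)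
    {g : ι → Z → ℝ} (hg : ∀ i, Measurable (g i)) {b : ℝ} (hb : 0 < b)
    (hgb : ∀ i z, g i z ∈ Set.Icc 0 b) {η : ℝ} (hη : 0 < η) (hη1 : η ≤ 1) :
    (Measure.pi fun _ : Fin n => P) {S | ∃ i, 2 * signMean (fun σ => radSup g σ S) +
      3 * b * Real.sqrt (n * Real.log (1 / η) / 2) < ∑ k, ((∫ z, g i z ∂P) - g i (S k))} ≤
      ENNReal.ofReal η := by
  set Q := Measure.pi fun _ : Fin n => P
  have hC : ∀ i z, |g i z| ≤ b := fun i z => abs_le.2 ⟨by linarith [(hgb i z).1], (hgb i z).2⟩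
  have hd : ∀ i z z', |g i z - g i z'| ≤ b := fun i z z' => abs_sub_le_iff.2
    ⟨by linarith [(hgb i z).2, (hgb i z').1], by linarith [(hgb i z').2, (hgb i z).1]⟩
  have hgk : ∀ i (k : Fin n), Measurable fun S : Fin n → Z => g i (S k) := fun i k =>
    (hg i).comp (measurable_pi_apply k)
  set A : (Fin n → Z) → ℝ := fun S => ⨆ i, ∑ k, ((∫ z, g i z ∂P) - g i (S k)) with hA
  set B : (Fin n → Z) → ℝ := fun S => signMean (fun σ => radSup g σ S) with hB
  have hAm : Measurable A := Measurable.iSup fun i =>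
    Finset.measurable_sum _ fun k _ => (hgk i k).const_sub _
  have hBm : Measurable B :=
    (Finset.measurable_sum _ fun σ _ => measurable_radSup hg σ).const_mul _
  have hAC : ∀ S, |A S| ≤ n * (2 * b) := fun S => abs_iSup_le_of_finite fun i =>
    abs_sum_le_of_abs_le fun k => (abs_sub _ _).trans (by
      linarith [hC i (S k), abs_integral_le_of_abs_le (μ := P) (hC i)])
  have hBC : ∀ S, |B S| ≤ n * b := fun S => abs_signMean_le fun σ => abs_radSup_le hC _ _
  have hupd : ∀ (S : Fin n → Z) k z (w : Fin n → ℝ) i, (∀ j, |w j| = 1) →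
      |(∑ j, w j * g i (Function.update S k z j)) - ∑ j, w j * g i (S j)| ≤ b := by
    intro S k z w i hw
    rw [← Finset.sum_sub_distrib, Finset.sum_eq_single k]
    · rw [Function.update_self, ← mul_sub, abs_mul, hw, one_mul]
      exact hd _ _ _
    · intro j _ hj
      rw [Function.update_of_ne hj, sub_self]
    · simp
  have hAd : ∀ S k z, |A (Function.update S k z) - A S| ≤ b := by
    intro S k z
    refine abs_iSup_sub_iSup_le fun i => ?_
    have := hupd S k z (fun _ => -1) i (by simp)
    convert this using 2
    simp only [Finset.sum_sub_distrib, neg_mul, one_mul, Finset.sum_neg_distrib]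
    ring
  have hBd : ∀ S k z, |B (Function.update S k z) - B S| ≤ b := by
    intro S k z
    rw [hB, ← signMean_sub]
    refine abs_signMean_le fun σ => abs_iSup_sub_iSup_le fun i => ?_
    exact hupd S k z (fun j => ((σ j : ℤ) : ℝ)) i fun j => abs_units_cast _
  have hmean : ∫ S, (A S - 2 * B S) ∂Q ≤ 0 := by
    rw [integral_sub (integrable_of_abs_le hAm hAC) ((integrable_of_abs_le hBm hBC).const_mul 2),
      integral_const_mul, sub_nonpos]
    exact integral_iSup_dev_le P hg hC
  -- Changing one sample point moves `A` by at most `b` and `2B` by at most `2b`, hence the constant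
  -- `3b`.
  have h := measure_gt_le_of_bounded_differences P hn (Φ := fun S => A S - 2 * B S)
    (hAm.sub (hBm.const_mul 2)) (C := n * (2 * b) + 2 * (n * b)) (c := 3 * b)
    (fun S => (abs_sub _ _).trans (by
      rw [abs_mul, abs_two]
      linarith [hAC S, hBC S]))
    (by positivity)
    (fun S k z => by
      have e : A (Function.update S k z) - 2 * B (Function.update S k z) - (A S - 2 * B S) =
        (A (Function.update S k z) - A S) - 2 * (B (Function.update S k z) - B S) := by ring
      rw [e]
      refine (abs_sub _ _).trans ?_
      rw [abs_mul, abs_two]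
      linarith [hAd S k z, hBd S k z]) hη hη1
  refine (measure_mono fun S hS => ?_).trans h
  obtain ⟨i, hi⟩ := hS
  have := le_iSup_of_finite (fun i => ∑ k, ((∫ z, g i z ∂P) - g i (S k))) i
  simp only [Set.mem_ofPred_eq, hA, hB] at *
  linarith

/-- `measure_exists_dev_gt_le` for functions whose values lie in `[0, b]` almost surely. -/
lemma measure_exists_dev_gt_le_of_ae (P : Measure Z) [IsProbabilityMeasure P] {n : ℕ} (hn : 0 < n)
    {g : ι → Z → ℝ} (hg : ∀ i, Measurable (g i)) {b : ℝ} (hb : 0 < b)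
    (hgb : ∀ i, ∀ᵐ z ∂P, g i z ∈ Set.Icc 0 b) {η : ℝ} (hη : 0 < η) (hη1 : η ≤ 1) :
    (Measure.pi fun _ : Fin n => P) {S | ∃ i, 2 * signMean (fun σ => radSup g σ S) +
      3 * b * Real.sqrt (n * Real.log (1 / η) / 2) < ∑ k, ((∫ z, g i z ∂P) - g i (S k))} ≤
      ENNReal.ofReal η := by
  -- Clipping to `[0, b]` changes neither the integrals nor, almost surely, the values on the
  -- sample.
  have h := measure_exists_dev_gt_le P hn (g := fun i z => max 0 (min b (g i z)))
    (fun i => measurable_const.max (measurable_const.min (hg i))) hb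
    (fun i z => ⟨le_max_left _ _, max_le hb.le (min_le_left _ _)⟩) hη hη1
  have hae : ∀ i, ∀ᵐ z ∂P, max 0 (min b (g i z)) = g i z := fun i => by
    filter_upwards [hgb i] with z hz
    rw [min_eq_right hz.2, max_eq_right hz.1]
  have haeS : ∀ᵐ S ∂(Measure.pi fun _ : Fin n => P), ∀ i k,
      max 0 (min b (g i (S k))) = g i (S k) := by
    rw [ae_all_iff]
    refine fun i => ae_all_iff.2 fun k => ?_
    exact (Measure.tendsto_eval_ae_ae (μ := fun _ : Fin n => P) (i := k)).eventually (hae i)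
  refine le_trans (measure_mono_ae ?_) h
  filter_upwards [haeS] with S hS hS'
  obtain ⟨i, hi⟩ := hS'
  refine ⟨i, ?_⟩
  simp only [radSup, hS, integral_congr_ae (hae i)] at hi ⊢
  exact hi

end Symmetrization

/-! ### Counting the patterns that trees induce on a sample. -/

section Patterns

/-- The preorder traversal of a binary tree, leaves being recorded as `none`. -/
def preorder {α : Type*} : BinaryTree α → List (Option α)
  | .nil => [none]
  | .node a l r => some a :: (preorder l ++ preorder r)

lemma length_preorder {α : Type*} (T : BinaryTree α) :
    (preorder T).length + 1 = 2 * T.numLeaves := by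
  induction T with
  | nil => rfl
  | node a l r hl hr =>
    simp only [preorder, List.length_cons, List.length_append, BinaryTree.numLeaves]
    omega

/-- The traversal is a prefix-free code. The trailing words `s`, `s'` are what lets the induction
split off the left subtree. -/
lemma eq_of_preorder_append_eq {α : Type*} (T T' : BinaryTree α) (s s' : List (Option α))
    (h : preorder T ++ s = preorder T' ++ s') : T = T' ∧ s = s' := by
  induction T generalizing T' s s' with
  | nil =>
    cases T' with
    | nil => simpa [preorder] using h
    | node a l r => simp [preorder] at h
  | node a l r hl hr =>
    cases T' with
    | nil => simp [preorder] at h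
    | node a' l' r' =>
      simp only [preorder, List.cons_append, List.cons.injEq, Option.some.injEq,
        List.append_assoc] at h
      obtain ⟨rfl, h⟩ := h
      obtain ⟨rfl, h'⟩ := hl _ _ _ h
      obtain ⟨rfl, rfl⟩ := hr _ _ _ h'
      exact ⟨rfl, rfl⟩

lemma preorder_injective {α : Type*} : Function.Injective (preorder (α := α)) := fun T T' h =>
  (eq_of_preorder_append_eq T T' [] [] (by simpa using h)).1

/-- The number of binary trees with `ℓ` leaves and node labels in `α`. -/
lemma card_le_of_numLeaves_eq {α : Type*} [Fintype α] {ℓ : ℕ} (s : Finset (BinaryTree α))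
    (hs : ∀ T ∈ s, T.numLeaves = ℓ) : s.card ≤ (Fintype.card α + 1) ^ (2 * ℓ) := by
  classical
  -- A tree with `ℓ` leaves is encoded by a word of exactly `2ℓ - 1` letters from the labels and the
  -- leaf symbol.
  have h1 : s.card ≤ ((Finset.univ : Finset (List.Vector (Option α) (2 * ℓ - 1))).image
      List.Vector.toList).card := by
    refine Finset.card_le_card_of_injOn preorder (fun T hT => ?_) preorder_injective.injOn
    refine Finset.mem_coe.2 (Finset.mem_image.2 ⟨⟨preorder T, ?_⟩, Finset.mem_univ _, rfl⟩)
    have := length_preorder T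
    rw [hs T hT] at this
    omega
  refine h1.trans (Finset.card_image_le.trans ?_)
  rw [Finset.card_univ, card_vector, Fintype.card_option]
  exact Nat.pow_le_pow_right (Nat.succ_pos _) (Nat.sub_le _ _)

lemma numLeaves_map {α β : Type*} (f : α → β) (T : BinaryTree α) :
    (T.map f).numLeaves = T.numLeaves := by
  induction T with
  | nil => rfl
  | node a l r hl hr => simp [BinaryTree.map, hl, hr]

variable {D n : ℕ}

/-- A split, seen through a sample: its coordinate and the number of sample points above the
threshold. -/
noncomputable def splitLabel (u : Fin n → Fin D → ℝ) (s : Fin D × ℝ) : Fin D × Fin (n + 1) :=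
  (s.1, ⟨(Finset.univ.filter fun k => s.2 ≤ u k s.1).card,
    Nat.lt_succ_of_le ((Finset.card_le_univ _).trans_eq (Fintype.card_fin n))⟩)

/-- For a fixed coordinate the sets of sample points above a threshold are nested, so their
cardinality determines them. -/
lemma le_iff_le_of_splitLabel_eq {u : Fin n → Fin D → ℝ} {s s' : Fin D × ℝ}
    (h : splitLabel u s = splitLabel u s') (k : Fin n) : s.2 ≤ u k s.1 ↔ s'.2 ≤ u k s'.1 := by
  obtain ⟨i, t⟩ := s
  obtain ⟨i', t'⟩ := s'
  simp only [splitLabel, Prod.mk.injEq, Fin.mk.injEq] at h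
  obtain ⟨rfl, h⟩ := h
  suffices hs : (Finset.univ.filter fun k => t ≤ u k i) = Finset.univ.filter fun k => t' ≤ u k i by
    simpa using Finset.ext_iff.1 hs k
  rcases le_total t t' with htt | htt
  · exact (Finset.eq_of_subset_of_card_le
      (Finset.monotone_filter_right _ fun k _ hk => htt.trans hk) h.le).symm
  · exact Finset.eq_of_subset_of_card_le
      (Finset.monotone_filter_right _ fun k _ hk => htt.trans hk) h.ge

/-- Trees with the same labels partition the sample in the same way. -/
lemma exists_leaf_map_of_map_splitLabel_eq (u : Fin n → Fin D → ℝ) (T T' : SplitTree D)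
    (h : T.map (splitLabel u) = T'.map (splitLabel u)) :
    ∃ e : Leaf T' → Leaf T, ∀ k, e (leafAt T' (u k)) = leafAt T (u k) := by
  induction T generalizing T' with
  | nil =>
    cases T' with
    | nil => exact ⟨id, fun k => rfl⟩
    | node s l r => simp [BinaryTree.map] at h
  | node s l r hl hr =>
    cases T' with
    | nil => simp [BinaryTree.map] at h
    | node s' l' r' =>
      simp only [BinaryTree.map, BinaryTree.node.injEq] at h
      obtain ⟨e₁, h₁⟩ := hl _ h.2.1
      obtain ⟨e₂, h₂⟩ := hr _ h.2.2
      refine ⟨Sum.map e₁ e₂, fun k => ?_⟩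
      have hk := le_iff_le_of_splitLabel_eq h.1 k
      by_cases hs : s.2 ≤ u k s.1
      · have hs' := hk.1 hs
        simp only [leafAt, hs, hs']
        exact congrArg Sum.inr (h₂ k)
      · have hs' : ¬ s'.2 ≤ u k s'.1 := fun h' => hs (hk.2 h')
        simp only [leafAt, hs, hs']
        exact congrArg Sum.inl (h₁ k)

lemma exists_fixedClass_eqOn_of_map_splitLabel_eq {d : ℕ} (ψ : Input d → Fin D → ℝ)
    (B : Set (Input d)) (x : Fin n → Input d) {T T' : SplitTree D}
    (h : T.map (splitLabel fun k => ψ (x k)) = T'.map (splitLabel fun k => ψ (x k)))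
    {f : Input d → ℝ} (hf : f ∈ fixedClass ψ B T) :
    ∃ f' ∈ fixedClass ψ B T', ∀ k, f (x k) = f' (x k) := by
  obtain ⟨w, hw, rfl⟩ := hf
  obtain ⟨e, he⟩ := exists_leaf_map_of_map_splitLabel_eq (fun k => ψ (x k)) T T' h
  exact ⟨predict ψ T' (w ∘ e), ⟨w ∘ e, fun j => hw _, rfl⟩, fun k => by simp [predict, he]⟩

lemma log_card_labels_le (D n ℓ : ℕ) (hn : 0 < n) :
    Real.log (((D * (n + 1) + 1) ^ (2 * ℓ) : ℕ) : ℝ) ≤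
      4 * (ℓ * Real.log (Real.exp 1 * n * D)) := by
  -- For `D = 0` both sides vanish: the count is 1, and `Real.log 0 = 0`.
  rcases Nat.eq_zero_or_pos D with rfl | hD
  · simp
  have hn' : (1 : ℝ) ≤ n := by exact_mod_cast hn
  have hD' : (1 : ℝ) ≤ D := by exact_mod_cast hD
  have he : (2 : ℝ) ≤ Real.exp 1 := by linarith [Real.add_one_le_exp (1 : ℝ)]
  have hnD : (1 : ℝ) ≤ n * D := by nlinarith
  -- As `nD ≥ 1`, the left side is at most `3nD ≤ (2nD)²`, and `2 ≤ e`. This square and the exponent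
  -- `2ℓ` give the factor `4ℓ`.
  have h1 : (D * (n + 1) + 1 : ℝ) ≤ (Real.exp 1 * n * D) ^ 2 := by
    have h2 : (2 * (n * D)) ^ 2 ≤ (Real.exp 1 * n * D) ^ 2 := by
      rw [mul_assoc]
      gcongr
    nlinarith
  push_cast
  rw [Real.log_pow]
  have h3 := Real.log_le_log (by positivity) h1
  rw [Real.log_pow] at h3
  push_cast at h3 ⊢
  nlinarith [(Nat.cast_nonneg ℓ : (0 : ℝ) ≤ ℓ)]

end Patterns

/-! ### From all trees to trees with fixed splits. -/

section Rademacher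

variable {d D n ℓ : ℕ}

lemma bddAbove_range_rademacher {S : Fin n → Input d × ℝ} {G : Set (Input d → ℝ)} {F : ℝ}
    (hG : ∀ f ∈ G, ∀ k, |f (S k).1| ≤ F) (σ : Fin n → ℤˣ) :
    BddAbove (Set.range fun f : G => (1 / (n : ℝ)) * ∑ i, ((σ i : ℤ) : ℝ) *
      (f : Input d → ℝ) (S i).1) := by
  refine ⟨(1 / (n : ℝ)) * (n * F), ?_⟩
  rintro _ ⟨f, rfl⟩
  refine mul_le_mul_of_nonneg_left ?_ (by positivity)
  refine (le_abs_self _).trans (abs_sum_le_of_abs_le fun k => ?_)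
  rw [abs_mul, abs_units_cast, one_mul]
  exact hG f f.2 k

lemma empRademacher_eq_signMean (S : Fin n → Input d × ℝ) (G : Set (Input d → ℝ)) :
    empRademacher S G = signMean fun σ => ⨆ f : G, (1 / (n : ℝ)) * ∑ i, ((σ i : ℤ) : ℝ) *
      (f : Input d → ℝ) (S i).1 := rfl

lemma empRademacher_le (hn : 0 < n) {S : Fin n → Input d × ℝ} {G : Set (Input d → ℝ)} {F : ℝ}
    (hF : 0 ≤ F) (hG : ∀ f ∈ G, ∀ k, |f (S k).1| ≤ F) : empRademacher S G ≤ F := by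
  rw [empRademacher_eq_signMean, ← signMean_const (n := n) F]
  refine signMean_mono fun σ => Real.iSup_le (fun f => ?_) hF
  have hn' : (0 : ℝ) < n := by exact_mod_cast hn
  rw [one_div, inv_mul_le_iff₀ hn']
  refine (le_abs_self _).trans (abs_sum_le_of_abs_le fun k => ?_)
  rw [abs_mul, abs_units_cast, one_mul]
  exact hG f f.2 k

/-- The Rademacher average of finitely many trees with `ℓ` leaves is controlled by that of trees
with fixed splits. -/
lemma signMean_iSup_treeClass_le (hn : 0 < n) {ψ : Input d → Fin D → ℝ} {B : Set (Input d)}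
    {S : Fin n → Input d × ℝ} {F : ℝ} (hF0 : 0 ≤ F)
    (hF : ∀ f ∈ treeClass ψ B ℓ, ∀ k, |f (S k).1| ≤ F)
    {ι : Type*} [Fintype ι] [Nonempty ι] (f : ι → Input d → ℝ) (hf : ∀ i, f i ∈ treeClass ψ B ℓ) :
    signMean (fun σ => ⨆ i, ∑ k, ((σ k : ℤ) : ℝ) * f i (S k).1) ≤
      n * (maxEmpRademacher ψ B ℓ S + 4 * supEmpNorm S (treeClass ψ B ℓ) *
        Real.sqrt (ℓ * Real.log (Real.exp 1 * n * D) / n)) := by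
  classical
  have hn' : (0 : ℝ) < n := by exact_mod_cast hn
  choose T hTℓ hfT using hf
  set x : Fin n → Input d := fun k => (S k).1
  set q : ι → BinaryTree (Fin D × Fin (n + 1)) :=
    fun i => (T i).map (splitLabel fun k => ψ (x k)) with hq
  set N := (D * (n + 1) + 1) ^ (2 * ℓ) with hN
  have hcard : (Finset.univ.image q).card ≤ N := by
    have := card_le_of_numLeaves_eq (ℓ := ℓ) (Finset.univ.image q) (by
      intro T' hT'
      obtain ⟨i, -, rfl⟩ := Finset.mem_image.1 hT'
      rw [hq, numLeaves_map, hTℓ])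
    simpa using this
  set M := supEmpNorm S (treeClass ψ B ℓ) with hM
  have hbddM : BddAbove (Set.range fun f : treeClass ψ B ℓ =>
      (1 / (n : ℝ)) * ∑ i, ((f : Input d → ℝ) (S i).1) ^ 2) := by
    refine ⟨(1 / (n : ℝ)) * (n * F ^ 2), ?_⟩
    rintro _ ⟨f, rfl⟩
    refine mul_le_mul_of_nonneg_left ?_ (by positivity)
    refine (le_abs_self _).trans (abs_sum_le_of_abs_le fun k => ?_)
    rw [abs_pow]
    exact pow_le_pow_left₀ (abs_nonneg _) (hF f f.2 k) 2
  have hV : ∀ i, ∑ k, f i (S k).1 ^ 2 ≤ n * M ^ 2 := by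
    intro i
    have h1 := le_ciSup hbddM ⟨f i, T i, hTℓ i, hfT i⟩
    have h2 : M ^ 2 = ⨆ f : treeClass ψ B ℓ,
        (1 / (n : ℝ)) * ∑ i, ((f : Input d → ℝ) (S i).1) ^ 2 :=
      Real.sq_sqrt (Real.iSup_nonneg fun f => by positivity)
    rw [← h2, one_div, inv_mul_le_iff₀ hn'] at h1
    exact h1
  have hsub : ∀ T' : SplitTree D, T'.numLeaves = ℓ → ∀ f ∈ fixedClass ψ B T', ∀ k,
      |f (S k).1| ≤ F := fun T' hT' f hf => hF f ⟨T', hT', hf⟩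
  have hμ : ∀ c ∈ Finset.univ.image q,
      signMean (fun σ => ⨆ i : {i // q i = c}, ∑ k, ((σ k : ℤ) : ℝ) * f i (S k).1) ≤
        n * maxEmpRademacher ψ B ℓ S := by
    intro c hc
    obtain ⟨i₀, -, rfl⟩ := Finset.mem_image.1 hc
    have : Nonempty {i // q i = q i₀} := ⟨⟨i₀, rfl⟩⟩
    have hle : empRademacher S (fixedClass ψ B (T i₀)) ≤ maxEmpRademacher ψ B ℓ S := by
      refine le_ciSup (f := fun T : {T : SplitTree D // T.numLeaves = ℓ} =>
        empRademacher S (fixedClass ψ B T.1)) ⟨F, ?_⟩ ⟨T i₀, hTℓ i₀⟩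
      rintro _ ⟨T', rfl⟩
      exact empRademacher_le hn hF0 (hsub T'.1 T'.2)
    refine le_trans ?_ (mul_le_mul_of_nonneg_left hle hn'.le)
    rw [empRademacher_eq_signMean, ← signMean_const_mul]
    refine signMean_mono fun σ => ciSup_le fun i => ?_
    -- All trees in one pattern are compared with the fixed tree `T i₀`, whose class contains a
    -- function equal to `f i` on the sample.
    obtain ⟨f', hf', heq⟩ := exists_fixedClass_eqOn_of_map_splitLabel_eq ψ B x i.2 (hfT i)
    have h1 := le_ciSup (bddAbove_range_rademacher (hsub _ (hTℓ i₀)) σ) ⟨f', hf'⟩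
    simp only [x] at heq
    rw [one_div, inv_mul_le_iff₀ hn'] at h1
    simpa only [heq, one_div] using h1
  have h := signMean_iSup_le_of_classes q N hcard (fun k i => f i (S k).1) (n * M ^ 2)
    (n * maxEmpRademacher ψ B ℓ S) hV hμ
  refine h.trans ?_
  rw [mul_add]
  refine add_le_add le_rfl ?_
  have hM0 : 0 ≤ M := Real.sqrt_nonneg _
  have hΛ := log_card_labels_le D n ℓ hn
  set Λ := ℓ * Real.log (Real.exp 1 * n * D)
  -- Since `log N ≤ 4Λ`, the cost `2√(n M² log N)` of the union is at most `4 n M √(Λ/n)`.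
  have h3 : n * M ^ 2 * Real.log N ≤ (2 * (n * M)) ^ 2 * (Λ / n) := by
    have : (2 * (n * M)) ^ 2 * (Λ / n) = n * M ^ 2 * (4 * Λ) := by field_simp; ring
    rw [this]
    gcongr
  have h4 := Real.sqrt_le_sqrt h3
  rw [Real.sqrt_mul (sq_nonneg (2 * (n * M))), Real.sqrt_sq (by positivity)] at h4
  linarith

end Rademacher

/-! ### A countable sequentially dense subclass. -/

section CountableApproximation

open Filter Topology

variable {d D : ℕ} {ψ : Input d → Fin D → ℝ}

lemma mem_fixedClass_nil_iff {B : Set (Input d)} {f : Input d → ℝ} :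
    f ∈ fixedClass ψ B (.nil : SplitTree D) ↔ ∃ v ∈ B, f = fun x => inner ℝ v x := by
  constructor
  · rintro ⟨w, hw, rfl⟩
    exact ⟨w (), hw (), rfl⟩
  · rintro ⟨v, hv, rfl⟩
    exact ⟨fun _ => v, fun _ => hv, rfl⟩

lemma mem_fixedClass_node_iff {B : Set (Input d)} {f : Input d → ℝ} {s : Fin D × ℝ}
    {l r : SplitTree D} : f ∈ fixedClass ψ B (.node s l r) ↔
      ∃ g ∈ fixedClass ψ B l, ∃ h ∈ fixedClass ψ B r,
        f = fun x => if s.2 ≤ ψ x s.1 then h x else g x := by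
  constructor
  · rintro ⟨w, hw, rfl⟩
    refine ⟨_, ⟨fun j => w (Sum.inl j), fun j => hw _, rfl⟩, _,
      ⟨fun j => w (Sum.inr j), fun j => hw _, rfl⟩, funext fun x => ?_⟩
    by_cases hx : s.2 ≤ ψ x s.1
    · simp only [hx, if_true]
      exact congrArg (fun j => inner ℝ (w j) x) (if_pos hx)
    · simp only [hx, if_false]
      exact congrArg (fun j => inner ℝ (w j) x) (if_neg hx)
  · rintro ⟨_, ⟨w₁, hw₁, rfl⟩, _, ⟨w₂, hw₂, rfl⟩, rfl⟩
    refine ⟨Sum.elim w₁ w₂, fun j => ?_, funext fun x => ?_⟩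
    · rcases j with j | j
      exacts [hw₁ j, hw₂ j]
    · by_cases hx : s.2 ≤ ψ x s.1 <;> simp only [predict, leafAt, hx, if_true, if_false]
      exacts [rfl, rfl]

lemma measurable_of_mem_fixedClass (hψ : Measurable ψ) {B : Set (Input d)} {T : SplitTree D}
    {f : Input d → ℝ} (hf : f ∈ fixedClass ψ B T) : Measurable f := by
  induction T generalizing f with
  | nil =>
    obtain ⟨v, -, rfl⟩ := mem_fixedClass_nil_iff.1 hf
    exact (continuous_const.inner continuous_id).measurable
  | node s l r hl hr =>
    obtain ⟨g, hg, h, hh, rfl⟩ := mem_fixedClass_node_iff.1 hf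
    exact Measurable.ite (measurableSet_le measurable_const ((measurable_pi_apply s.1).comp hψ))
      (hr hh) (hl hg)

lemma countable_fixedClass {B : Set (Input d)} (hB : B.Countable) (T : SplitTree D) :
    (fixedClass ψ B T).Countable := by
  induction T with
  | nil =>
    refine (hB.image fun v x => inner ℝ v x).mono fun f hf => ?_
    obtain ⟨v, hv, rfl⟩ := mem_fixedClass_nil_iff.1 hf
    exact ⟨v, hv, rfl⟩
  | node s l r hl hr =>
    refine (hl.image2 hr fun g h x => if s.2 ≤ ψ x s.1 then h x else g x).mono fun f hf => ?_
    obtain ⟨g, hg, h, hh, rfl⟩ := mem_fixedClass_node_iff.1 hf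
    exact ⟨g, hg, h, hh, rfl⟩

/-- The trees with `ℓ` leaves, rational thresholds, and leaf vectors in `B`. -/
def ratTreeClass (ψ : Input d → Fin D → ℝ) (B : Set (Input d)) (ℓ : ℕ) : Set (Input d → ℝ) :=
  {f | ∃ T : BinaryTree (Fin D × ℚ), T.numLeaves = ℓ ∧
    f ∈ fixedClass ψ B (T.map (Prod.map id (Rat.cast : ℚ → ℝ)))}

lemma countable_ratTreeClass {B : Set (Input d)} (hB : B.Countable) (ℓ : ℕ) :
    (ratTreeClass ψ B ℓ).Countable := by
  have : Countable (BinaryTree (Fin D × ℚ)) := preorder_injective.countable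
  refine (Set.countable_iUnion fun T : BinaryTree (Fin D × ℚ) =>
    countable_fixedClass (ψ := ψ) hB (T.map (Prod.map id (Rat.cast : ℚ → ℝ)))).mono ?_
  rintro f ⟨T, -, hf⟩
  exact Set.mem_iUnion.2 ⟨T, hf⟩

lemma ratTreeClass_subset {B₀ B : Set (Input d)} (h : B₀ ⊆ B) (ℓ : ℕ) :
    ratTreeClass ψ B₀ ℓ ⊆ treeClass ψ B ℓ := by
  rintro f ⟨T, hT, w, hw, rfl⟩
  exact ⟨_, (numLeaves_map _ T).trans hT, w, fun j => h (hw j), rfl⟩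

/-- Rational thresholds must increase strictly to the true one, because the test is `≥`: points
passing it pass every approximate test, and points failing it eventually fail. Leaf vectors are
approximated from `B₀`. -/
lemma exists_seq_tendsto_of_mem_fixedClass {B₀ B : Set (Input d)} (h : B ⊆ closure B₀)
    (T : SplitTree D) {f : Input d → ℝ} (hf : f ∈ fixedClass ψ B T) :
    ∃ g : ℕ → Input d → ℝ, (∀ m, g m ∈ ratTreeClass ψ B₀ T.numLeaves) ∧
      ∀ x, Tendsto (fun m => g m x) atTop (𝓝 (f x)) := by
  induction T generalizing f with
  | nil =>
    obtain ⟨v, hv, rfl⟩ := mem_fixedClass_nil_iff.1 hf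
    obtain ⟨v', hv', hlim⟩ := mem_closure_iff_seq_limit.1 (h hv)
    exact ⟨fun m x => inner ℝ (v' m) x,
      fun m => ⟨.nil, rfl, mem_fixedClass_nil_iff.2 ⟨v' m, hv' m, rfl⟩⟩,
      fun x => hlim.inner tendsto_const_nhds⟩
  | node s l r hl hr =>
    obtain ⟨fl, hfl, fr, hfr, rfl⟩ := mem_fixedClass_node_iff.1 hf
    obtain ⟨gl, hgl, hgl'⟩ := hl hfl
    obtain ⟨gr, hgr, hgr'⟩ := hr hfr
    obtain ⟨t, -, ht, ht'⟩ := Real.exists_seq_rat_strictMono_tendsto s.2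
    refine ⟨fun m x => if (t m : ℝ) ≤ ψ x s.1 then gr m x else gl m x, fun m => ?_, fun x => ?_⟩
    · obtain ⟨Tl, hTl, hgl⟩ := hgl m
      obtain ⟨Tr, hTr, hgr⟩ := hgr m
      exact ⟨.node (s.1, t m) Tl Tr, by simp [hTl, hTr],
        mem_fixedClass_node_iff.2 ⟨_, hgl, _, hgr, rfl⟩⟩
    · by_cases hx : s.2 ≤ ψ x s.1
      · simpa only [hx, if_true, fun m => (ht m).le.trans hx] using hgr' x
      · simp only [hx, if_false]
        refine (hgl' x).congr' ?_
        filter_upwards [ht'.eventually (lt_mem_nhds (not_le.1 hx))] with m hm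
        rw [if_neg (not_le.2 hm)]

/-- The class of regression trees has a countable subclass which is sequentially dense for
pointwise convergence. -/
lemma exists_countable_dense_treeClass (B : Set (Input d)) (ℓ : ℕ) :
    ∃ G : Set (Input d → ℝ), G.Countable ∧ G ⊆ treeClass ψ B ℓ ∧ ∀ f ∈ treeClass ψ B ℓ,
      ∃ g : ℕ → Input d → ℝ, (∀ m, g m ∈ G) ∧ ∀ x, Tendsto (fun m => g m x) atTop (𝓝 (f x)) := by
  obtain ⟨B₀, hB₀, hc, hd⟩ := TopologicalSpace.IsSeparable.of_separableSpace B
    |>.exists_countable_dense_subset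
  refine ⟨ratTreeClass ψ B₀ ℓ, countable_ratTreeClass hc ℓ, ratTreeClass_subset hB₀ ℓ, ?_⟩
  rintro f ⟨T, rfl, hf⟩
  exact exists_seq_tendsto_of_mem_fixedClass hd T hf

end CountableApproximation

/-! ### The squared loss and the bound for finite families of trees. -/

section Risk

open Filter Topology

variable {d D n ℓ : ℕ}

lemma sq_sub_mem_Icc {a y R F : ℝ} (ha : |a| ≤ F) (hy : |y| ≤ R) :
    (a - y) ^ 2 ∈ Set.Icc 0 ((R + F) ^ 2) := by
  refine ⟨sq_nonneg _, ?_⟩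
  rw [← sq_abs (a - y)]
  exact pow_le_pow_left₀ (abs_nonneg _) ((abs_sub _ _).trans (by linarith)) 2

/-- The difference factors as `(a + a' - 2y)(a - a')`, with first factor at most `2(R + F)`. This is
the Lipschitz hypothesis of the contraction principle. -/
lemma abs_sq_sub_sq_sub_le {a a' y R F : ℝ} (ha : |a| ≤ F) (ha' : |a'| ≤ F) (hy : |y| ≤ R) :
    |(a - y) ^ 2 - (a' - y) ^ 2| ≤ |2 * (R + F) * a - 2 * (R + F) * a'| := by
  have h : (a - y) ^ 2 - (a' - y) ^ 2 = (a + a' - 2 * y) * (a - a') := by ring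
  rw [h, ← mul_sub, abs_mul, abs_mul]
  refine mul_le_mul_of_nonneg_right (le_trans ?_ (le_abs_self _)) (abs_nonneg _)
  have h1 := abs_le.1 ha
  have h2 := abs_le.1 ha'
  have h3 := abs_le.1 hy
  exact abs_le.2 ⟨by linarith, by linarith⟩

lemma tendsto_risk {P : Measure (Input d × ℝ)} [IsProbabilityMeasure P] {K R F : ℝ}
    (hX : ∀ᵐ z ∂P, ‖z.1‖ ≤ K) (hY : ∀ᵐ z ∂P, |z.2| ≤ R) {f : Input d → ℝ} {g : ℕ → Input d → ℝ}
    (hgm : ∀ m, Measurable (g m)) (hg : ∀ m x, ‖x‖ ≤ K → |g m x| ≤ F)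
    (hlim : ∀ x, Tendsto (fun m => g m x) atTop (𝓝 (f x))) :
    Tendsto (fun m => risk P (g m)) atTop (𝓝 (risk P f)) := by
  refine tendsto_integral_of_dominated_convergence (fun _ => (R + F) ^ 2) (fun m => ?_)
    (integrable_const _) (fun m => ?_) (ae_of_all _ fun z => ?_)
  · exact ((((hgm m).comp measurable_fst).sub measurable_snd).pow_const 2).aestronglyMeasurable
  · filter_upwards [hX, hY] with z hzX hzY
    have := sq_sub_mem_Icc (hg m z.1 hzX) hzY
    rw [Real.norm_of_nonneg this.1]
    exact this.2
  · exact ((hlim z.1).sub_const _).pow 2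

lemma tendsto_empRisk (S : Fin n → Input d × ℝ) {f : Input d → ℝ} {g : ℕ → Input d → ℝ}
    (hlim : ∀ x, Tendsto (fun m => g m x) atTop (𝓝 (f x))) :
    Tendsto (fun m => empRisk S (g m)) atTop (𝓝 (empRisk S f)) :=
  (tendsto_finsetSum _ fun k _ => ((hlim (S k).1).sub_const _).pow 2).const_mul _

/-- The right-hand side of the generalization bound. -/
noncomputable def genBound (ψ : Input d → Fin D → ℝ) (B : Set (Input d)) (ℓ : ℕ) (R F δ : ℝ)
    (S : Fin n → Input d × ℝ) : ℝ :=
  4 * (R + F) * (maxEmpRademacher ψ B ℓ S + 4 * supEmpNorm S (treeClass ψ B ℓ) *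
    Real.sqrt (ℓ * Real.log (Real.exp 1 * n * D) / n) +
    (R + 2 * F) * Real.sqrt (Real.log (2 / δ) / (2 * n)))

lemma measure_exists_finite_gt_genBound_le (hn : 0 < n) {ψ : Input d → Fin D → ℝ}
    (hψ : Measurable ψ) {B : Set (Input d)} {P : Measure (Input d × ℝ)} [IsProbabilityMeasure P]
    {K R F : ℝ} (hX : ∀ᵐ z ∂P, ‖z.1‖ ≤ K) (hY : ∀ᵐ z ∂P, |z.2| ≤ R)
    (hF : ∀ f ∈ treeClass ψ B ℓ, ∀ x, ‖x‖ ≤ K → |f x| ≤ F) (hR0 : 0 ≤ R) (hF0 : 0 ≤ F)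
    (hRF : 0 < R + F) {δ : ℝ} (hδ : 0 < δ) (hδ' : δ ≤ 2)
    {ι : Type*} [Fintype ι] [Nonempty ι] (f : ι → Input d → ℝ)
    (hf : ∀ i, f i ∈ treeClass ψ B ℓ) :
    (Measure.pi fun _ : Fin n => P)
      {S | ∃ i, genBound ψ B ℓ R F δ S < risk P (f i) - empRisk S (f i)} ≤
      ENNReal.ofReal (δ / 2) := by
  have hn' : (0 : ℝ) < n := by exact_mod_cast hn
  set g : ι → Input d × ℝ → ℝ := fun i z => (f i z.1 - z.2) ^ 2 with hg
  have hgm : ∀ i, Measurable (g i) := fun i => by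
    obtain ⟨T, -, hT⟩ := hf i
    exact (((measurable_of_mem_fixedClass hψ hT).comp measurable_fst).sub
      measurable_snd).pow_const 2
  have hgb : ∀ i, ∀ᵐ z ∂P, g i z ∈ Set.Icc 0 ((R + F) ^ 2) := fun i => by
    filter_upwards [hX, hY] with z hzX hzY
    exact sq_sub_mem_Icc (hF _ (hf i) _ hzX) hzY
  have h := measure_exists_dev_gt_le_of_ae P hn hgm (pow_pos hRF 2) hgb (η := δ / 2)
    (by linarith) (by linarith)
  have hXS : ∀ᵐ S ∂(Measure.pi fun _ : Fin n => P), ∀ k, ‖(S k).1‖ ≤ K := ae_all_iff.2 fun k =>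
    (Measure.tendsto_eval_ae_ae (μ := fun _ : Fin n => P) (i := k)).eventually hX
  have hYS : ∀ᵐ S ∂(Measure.pi fun _ : Fin n => P), ∀ k, |(S k).2| ≤ R := ae_all_iff.2 fun k =>
    (Measure.tendsto_eval_ae_ae (μ := fun _ : Fin n => P) (i := k)).eventually hY
  refine le_trans (measure_mono_ae ?_) h
  filter_upwards [hXS, hYS] with S hSX hSY hS
  obtain ⟨i, hi⟩ := hS
  refine ⟨i, ?_⟩
  have hFS : ∀ f ∈ treeClass ψ B ℓ, ∀ k, |f (S k).1| ≤ F := fun f hf k => hF f hf _ (hSX k)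
  have hcontr := signMean_iSup_contraction (fun _ : ι => (0 : ℝ))
    (fun k i => 2 * (R + F) * f i (S k).1) (fun k i => g i (S k))
    fun k i j => abs_sq_sub_sq_sub_le (hFS _ (hf i) k) (hFS _ (hf j) k) (hSY k)
  have hnn : 0 ≤ 2 * (R + F) := by positivity
  simp only [zero_add, mul_left_comm _ (2 * (R + F)), ← Finset.mul_sum,
    ← Real.mul_iSup_of_nonneg hnn] at hcontr
  rw [signMean_const_mul] at hcontr
  have htree := mul_le_mul_of_nonneg_left (signMean_iSup_treeClass_le hn hF0 hFS f hf) hnn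
  have hL : 1 / (δ / 2) = 2 / δ := by field_simp
  have hsqrt : Real.sqrt (n * Real.log (2 / δ) / 2) =
      n * Real.sqrt (Real.log (2 / δ) / (2 * n)) := by
    have e : n * Real.log (2 / δ) / 2 = (n : ℝ) ^ 2 * (Real.log (2 / δ) / (2 * n)) := by
      field_simp
    rw [e, Real.sqrt_mul (sq_nonneg _), Real.sqrt_sq hn'.le]
  have hdev : ∑ k, ((∫ z, g i z ∂P) - g i (S k)) = n * (risk P (f i) - empRisk S (f i)) := by
    simp only [Finset.sum_sub_distrib, Finset.sum_const, Finset.card_univ, Fintype.card_fin,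
      nsmul_eq_mul, risk, empRisk, hg]
    field_simp
  rw [hL, hsqrt, hdev]
  refine lt_of_le_of_lt ?_ (mul_lt_mul_of_pos_left hi hn')
  have hs := mul_nonneg hn'.le (Real.sqrt_nonneg (Real.log (2 / δ) / (2 * n)))
  -- The losses lie in `[0, (R+F)²]`, so McDiarmid gives `3(R+F)²`, which is weakened by `3(R+F) ≤
  -- 4(R+2F)`.
  have hmono : 3 * (R + F) ^ 2 * (n * Real.sqrt (Real.log (2 / δ) / (2 * n))) ≤
      4 * (R + F) * (R + 2 * F) * (n * Real.sqrt (Real.log (2 / δ) / (2 * n))) :=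
    mul_le_mul_of_nonneg_right (by nlinarith) hs
  simp only [genBound, radSup] at *
  linarith

lemma risk_le {P : Measure (Input d × ℝ)} [IsProbabilityMeasure P] {K R F : ℝ}
    (hX : ∀ᵐ z ∂P, ‖z.1‖ ≤ K) (hY : ∀ᵐ z ∂P, |z.2| ≤ R) {f : Input d → ℝ}
    (hf : ∀ x, ‖x‖ ≤ K → |f x| ≤ F) : risk P f ≤ (R + F) ^ 2 := by
  have h : ∀ᵐ z ∂P, ‖(f z.1 - z.2) ^ 2‖ ≤ (R + F) ^ 2 := by
    filter_upwards [hX, hY] with z hzX hzY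
    have := sq_sub_mem_Icc (hf z.1 hzX) hzY
    rw [Real.norm_of_nonneg this.1]
    exact this.2
  exact (le_abs_self _).trans (by simpa [risk] using norm_integral_le_of_norm_le_const h)

end Risk

end RegTree

/-! ### From finite families to the whole class. -/

/-- `P` is the law of `(X, Y)`; the sample `S` is i.i.d. with law `P`, that is, it has law `P^n`.
The (outer) probability that the inequality fails for some `f` in the class is at most `δ / 2`. -/
theorem theorem2 (d D n ℓ : ℕ) (hn : 0 < n)
    (ψ : RegTree.Input d → Fin D → ℝ) (hψ : Measurable ψ)
    (B : Set (RegTree.Input d))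
    (P : MeasureTheory.Measure (RegTree.Input d × ℝ)) [MeasureTheory.IsProbabilityMeasure P]
    (K R F : ℝ)
    (hX : ∀ᵐ z ∂P, ‖z.1‖ ≤ K) (hY : ∀ᵐ z ∂P, |z.2| ≤ R)
    (hF : ∀ f ∈ RegTree.treeClass ψ B ℓ, ∀ x, ‖x‖ ≤ K → |f x| ≤ F)
    (δ : ℝ) (hδ : 0 < δ) (hδ' : δ ≤ 2) :
    (MeasureTheory.Measure.pi fun _ : Fin n => P)
      {S | ¬ ∀ f ∈ RegTree.treeClass ψ B ℓ,
        RegTree.risk P f - RegTree.empRisk S f ≤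
          4 * (R + F) *
            (RegTree.maxEmpRademacher ψ B ℓ S
              + 4 * RegTree.supEmpNorm S (RegTree.treeClass ψ B ℓ)
                  * Real.sqrt (ℓ * Real.log (Real.exp 1 * n * D) / n)
              + (R + 2 * F) * Real.sqrt (Real.log (2 / δ) / (2 * n)))}
      ≤ ENNReal.ofReal (δ / 2) := by
  rcases (RegTree.treeClass ψ B ℓ).eq_empty_or_nonempty with hempty | ⟨f₀, hf₀⟩
  · simp [hempty]
  obtain ⟨z₀, hz₀X, hz₀Y⟩ := (hX.and hY).exists
  have hR0 : 0 ≤ R := (abs_nonneg _).trans hz₀Y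
  have hF0 : 0 ≤ F := (abs_nonneg _).trans (hF f₀ hf₀ z₀.1 hz₀X)
  -- If `R + F = 0`, the range of the loss has zero length and the deviation inequality does not
  -- apply; but the bound is 0, the risk is at most 0 and the empirical risk is nonnegative.
  rcases (add_nonneg hR0 hF0).eq_or_lt with hRF | hRF
  · refine le_trans (le_of_eq ?_) zero_le
    refine (congrArg _ ?_).trans measure_empty
    refine Set.eq_empty_of_forall_notMem fun S hS => hS fun f hf => ?_
    have h1 := RegTree.risk_le hX hY (hF f hf)
    have h2 : 0 ≤ RegTree.empRisk S f := by unfold RegTree.empRisk; positivity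
    rw [← hRF] at h1 ⊢
    linarith
  obtain ⟨G, hGc, hGsub, hG⟩ := RegTree.exists_countable_dense_treeClass (ψ := ψ) B ℓ
  have hGne : G.Nonempty := by
    obtain ⟨g, hg, -⟩ := hG f₀ hf₀
    exact ⟨g 0, hg 0⟩
  obtain ⟨e, he⟩ := hGc.exists_eq_range hGne
  have heG : ∀ m, e m ∈ G := fun m => he ▸ Set.mem_range_self m
  let bad : ℕ → Set (Fin n → RegTree.Input d × ℝ) := fun m =>
    {S | ∃ i : Fin (m + 1), RegTree.genBound ψ B ℓ R F δ S <
      RegTree.risk P (e i) - RegTree.empRisk S (e i)}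
  have hmono : Monotone bad := by
    rintro m m' hm S ⟨i, hi⟩
    exact ⟨⟨i, by omega⟩, hi⟩
  have hsub : {S | ¬ ∀ f ∈ RegTree.treeClass ψ B ℓ, RegTree.risk P f - RegTree.empRisk S f ≤
      RegTree.genBound ψ B ℓ R F δ S} ⊆ ⋃ m, bad m := by
    intro S hS
    simp only [Set.mem_ofPred_eq, not_forall, not_le] at hS
    obtain ⟨f, hf, hlt⟩ := hS
    obtain ⟨g, hg, hlim⟩ := hG f hf
    have htend := (RegTree.tendsto_risk hX hY (fun m => by
      obtain ⟨T, -, hT⟩ := hGsub (hg m)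
      exact RegTree.measurable_of_mem_fixedClass hψ hT) (fun m => hF _ (hGsub (hg m))) hlim).sub
      (RegTree.tendsto_empRisk S hlim)
    -- The bound does not depend on `f`, so a strict violation by `f` persists for a member of the
    -- countable subclass.
    obtain ⟨m, hm⟩ := (htend.eventually (lt_mem_nhds hlt)).exists
    obtain ⟨j, hj⟩ : g m ∈ Set.range e := he ▸ hg m
    rw [← hj] at hm
    exact Set.mem_iUnion.2 ⟨j, ⟨j, by omega⟩, hm⟩
  refine (measure_mono hsub).trans ?_
  -- Continuity from below along a monotone sequence holds for the outer measure, so the sets `bad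
  -- m` need not be measurable; their common bound involves the whole class and does not grow with
  -- `m`.
  rw [hmono.measure_iUnion]
  exact iSup_le fun m => RegTree.measure_exists_finite_gt_genBound_le hn hψ hX hY hF hR0 hF0 hRF
    hδ hδ' (fun i : Fin (m + 1) => e i) fun i => hGsub (heG i)
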